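/- Let $\Gamma$ be a finite set of glues and let $D=\{(1,0),(0,1),(-1,0),(0,-1)\}$ be the set of unit vectors of $\mathbb Z^2$. A tile type is a map $t\colon D\to\Gamma$, $d\mapsto t_d$. A temperature-1 tile assembly system (TAS) is a pair $(T,\sigma)$ of a finite set $T$ of tile types and a tile type $\sigma$, the seed, which need not belong to $T$. An assembly is a partial map $\alpha\colon\mathbb Z^2\rightharpoonup T\cup\{\sigma\}$ that, if $\sigma\notin T$, takes the value $\sigma$ at most once. Its binding graph has vertex set $\operatorname{dom}\alpha$ and an edge between $v$ and $v+d$ ($d\in D$, $v,v+d\in\operatorname{dom}\alpha$) exactly when $\alpha(v)_d=\alpha(v+d)_{-d}$. The assembly $\alpha$ is stable if its binding graph is connected, and producible if moreover $\alpha(0,0)=\sigma$. The system is confluent (deterministic) if any two producible assemblies agree on the intersection of their domains. A producible assembly is maximal if no producible assembly has a strictly larger domain. For finite words $m,p$ over $D$ with $p$ non-empty, write $\vec m,\vec p\in\mathbb Z^2$ for the sums of their letters. An ultimately periodic assembly path is a stable assembly $\alpha$ for which there are such $m$ and $p$ so that the walk from $(0,0)$ that follows the infinite word $mppp\cdots$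 visits no vertex twice, the binding graph of $\alpha$ is exactly the infinite path traced by this walk, and $\alpha(\vec m+i\vec p)=\alpha(\vec m)$ for all integers $i\ge 0$. **Theorem.** Let $(T,\sigma)$ be a confluent temperature-1 tile assembly system. Then it has a unique maximal producible assembly $\alpha_{\max}$, and either $\alpha_{\max}$ has finite domain or the system is para-periodic, that is, $\alpha_{\max}$ contains (as a restriction) an ultimately periodic assembly path. -/

import Mathlib

namespace TileAssembly

/-- The four directions of the square lattice. -/
inductive Dir
  | east
  | north
  | west
  | south

/-- The unit vector of a direction. -/
def Dir.vec : Dir → ℤ × ℤ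
  | .east => (1, 0)
  | .north => (0, 1)
  | .west => (-1, 0)
  | .south => (0, -1)

/-- The opposite direction. -/
def Dir.opp : Dir → Dir
  | .east => .west
  | .north => .south
  | .west => .east
  | .south => .north

theorem Dir.vec_ne_zero (d : Dir) : d.vec ≠ 0 := by
  cases d <;> simp [Dir.vec]

theorem Dir.vec_opp (d : Dir) : d.opp.vec = -d.vec := by
  cases d <;> simp [Dir.vec, Dir.opp]

theorem Dir.opp_opp (d : Dir) : d.opp.opp = d := by
  cases d <;> rfl

/-- The square lattice `ℤ²` as a graph: two points are adjacent when they differ by a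
unit vector. -/
def lattice : SimpleGraph (ℤ × ℤ) where
  Adj x y := ∃ d : Dir, x + d.vec = y
  symm := ⟨by
    rintro x y ⟨d, rfl⟩
    exact ⟨d.opp, by rw [Dir.vec_opp, add_neg_cancel_right]⟩⟩
  loopless := ⟨by
    rintro x ⟨d, hd⟩
    exact d.vec_ne_zero (by simpa using hd)⟩

/-- A tile type assigns a glue to each of the four sides. -/
abbrev Tile (Γ : Type*) := Dir → Γ

/-- A temperature-1 tile assembly system over the glue alphabet `Γ`: a finite set of tile types
and a seed tile type, which need not belong to that set. -/
structure TAS (Γ : Type*) where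
  tiles : Finset (Tile Γ)
  seed : Tile Γ

/-- A partial map from `ℤ²` to tile types. -/
abbrev Placement (Γ : Type*) := ℤ × ℤ → Option (Tile Γ)

namespace Placement

variable {Γ : Type*}

/-- The domain of a partial map. -/
def dom (α : Placement Γ) : Set (ℤ × ℤ) := {v | ∃ t, α v = some t}

/-- The binding graph: the subgraph of the lattice on the domain of `α`, whose edges join the
neighbours that carry the same glue on their common side. -/
def bindingGraph (α : Placement Γ) : lattice.Subgraph where
  verts := α.dom
  Adj v w := ∃ (d : Dir) (t t' : Tile Γ),
    v + d.vec = w ∧ α v = some t ∧ α w = some t' ∧ t d = t' d.opp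
  adj_sub := by
    rintro v w ⟨d, t, t', h, -⟩
    exact ⟨d, h⟩
  edge_vert := by
    rintro v w ⟨d, t, t', -, h, -⟩
    exact ⟨t, h⟩
  symm := ⟨by
    rintro v w ⟨d, t, t', rfl, hv, hw, hg⟩
    refine ⟨d.opp, t', t, ?_, hw, hv, ?_⟩
    · rw [Dir.vec_opp, add_neg_cancel_right]
    · rw [Dir.opp_opp, hg]⟩

/-- Stable: the binding graph is connected. -/
def Stable (α : Placement Γ) : Prop := α.bindingGraph.Connected

/-- Compatible: equal tiles on the common domain. -/
def Compatible (α β : Placement Γ) : Prop :=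
  ∀ v ∈ α.dom ∩ β.dom, α v = β v

/-- `β` contains `α`: it is defined on the domain of `α`, with the same tiles. -/
def Contains (β α : Placement Γ) : Prop :=
  ∀ v ∈ α.dom, β v = α v

end Placement

/-- The lattice walk that starts at `A` and follows the infinite word `κ` of directions;
its value at `n` is the `n`-th visited vertex. -/
def walkFrom (A : ℤ × ℤ) (κ : Stream' Dir) (n : ℕ) : ℤ × ℤ :=
  A + ∑ i ∈ Finset.range n, (κ.get i).vec

/-- The displacement vector of a finite word of directions. -/
def displacement (m : List Dir) : ℤ × ℤ := (m.map Dir.vec).sum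

/-- The ultimately periodic infinite word `m p p p ⋯`. -/
def ultPeriodicWord (m p : List Dir) (hp : p ≠ []) : Stream' Dir :=
  m ++ₛ Stream'.cycle p hp

/-- The subgraph `G` of the lattice is the forward infinite path that visits
`π 0, π 1, π 2, …` in this order, without repetition: its vertices are exactly the visited ones
and its edges are exactly the steps. -/
def IsInfinitePath (G : lattice.Subgraph) (π : ℕ → ℤ × ℤ) : Prop :=
  Function.Injective π ∧ G.verts = Set.range π ∧
    ∀ v w, G.Adj v w ↔ ∃ i, (v = π i ∧ w = π (i + 1)) ∨ (v = π (i + 1) ∧ w = π i)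

namespace TAS

variable {Γ : Type*}

/-- An assembly over `T`: only tile types of `T` or the seed are used, and a seed that is not one
of the tile types is used at most once. -/
def IsAssembly (T : TAS Γ) (α : Placement Γ) : Prop :=
  (∀ v t, α v = some t → t ∈ T.tiles ∨ t = T.seed) ∧
    (T.seed ∉ T.tiles → {v | α v = some T.seed}.Subsingleton)

/-- Producible: a stable assembly with the seed at the origin. -/
def Producible (T : TAS Γ) (α : Placement Γ) : Prop :=
  T.IsAssembly α ∧ α.Stable ∧ α 0 = some T.seed

/-- Confluent (directed, deterministic): any two producible assemblies are compatible. -/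
def Confluent (T : TAS Γ) : Prop :=
  ∀ α β : Placement Γ, T.Producible α → T.Producible β → α.Compatible β

/-- A maximal producible assembly: no producible assembly has a strictly larger domain. -/
def IsMaximalAssembly (T : TAS Γ) (α : Placement Γ) : Prop :=
  T.Producible α ∧ ∀ β : Placement Γ, T.Producible β → α.dom ⊆ β.dom → β.dom = α.dom

/-- An ultimately periodic assembly path over `T`: a stable assembly whose binding graph is the
infinite path `0.m p p p ⋯` from the origin, for some finite words `m` and `p ≠ []` of
directions, with the same tile at the beginning of every period. -/
def IsUltPeriodicAssemblyPath (T : TAS Γ) (α : Placement Γ) : Prop :=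
  T.IsAssembly α ∧ α.Stable ∧
    ∃ (m p : List Dir) (hp : p ≠ []),
      IsInfinitePath α.bindingGraph (walkFrom 0 (ultPeriodicWord m p hp)) ∧
      ∀ i : ℕ, α (displacement m + i • displacement p) = α (displacement m)

/-- Para-periodic: a maximal producible assembly contains an ultimately periodic assembly path. -/
def ParaPeriodic (T : TAS Γ) : Prop :=
  ∃ αmax : Placement Γ, T.IsMaximalAssembly αmax ∧
    ∃ α : Placement Γ, T.IsUltPeriodicAssemblyPath α ∧ αmax.Contains α

end TAS

end TileAssembly

/-! ### Directions, quarter turns and the squares beside an edge. -/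

namespace TileAssembly

/-! Confluence glues all producible assemblies into one, `TAS.union`, which is the unique maximal
assembly. The rest of the proof uses mainly its property `Bonds.Growing`: a neighbour seen at one
tile also occurs at every tile of the same type, unless its place `z` separates that tile from the
origin (`Anc`). Indeed, otherwise one may delete `z` and everything behind it from the union, put
the required tile at `z`, and still have a producible assembly. So patterns can be translated as
long as they do not run into separating points of their start. The target is a walk along bonds with
periodic steps and labels; jumping ahead as far as possible turns it into an induced, ultimately
periodic path (`Growing.exists_path`).

Let the domain be infinite. If infinitely many points have all their ancestors in one finite set, a
path to a very distant such point repeats a label beyond a box around that set. The segment in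
between, run forwards or backwards so that it does not drift towards the box, can be pumped
(`Growing.periodicWalk_of_not_deep`).

Otherwise (`Deep`) one follows walkers that keep a hand on the wall; they are deterministic and
reversible. Winding numbers around unit squares take the place of the Jordan curve theorem. They
show that closed orbits have bounded period (`Growing.exists_period_bound`), and that a walker
started at a point with more ancestors than a corresponding box can hold never repeats a state
(`Deep.exists_walker_injective`). Such a ray has arbitrarily late parting points, behind which it
stays forever. Two parting points with equal label and exit give a period if no ancestor is passed
over later. If one is, then either the ray has gone around it, and two such ancestors with equal
data give a period by following the walker of opposite hand (`Around.periodic`), or the edge to it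
is passed over from both ends and closes a pocket. Pockets cannot interleave
(`IsRay.pockets_noncrossing`), and an extremal choice of pocket gives a contradiction in
`Deep.periodicWalk`. -/

instance : DecidableEq Dir := fun a b => by
  cases a <;> cases b <;> first | exact isTrue rfl | exact isFalse (by intro h; cases h)

instance : Fintype Dir := ⟨{.east, .north, .west, .south}, by intro d; cases d <;> decide⟩

/-- Quarter turn of a direction, counterclockwise for `true` and clockwise for `false`. -/
def turn : Bool → Dir → Dir
  | true, .east => .north
  | true, .north => .west
  | true, .west => .south
  | true, .south => .east
  | false, .east => .south
  | false, .north => .east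
  | false, .west => .north
  | false, .south => .west

theorem turn_turn_not (h : Bool) (d : Dir) : turn h (turn (!h) d) = d := by
  cases h <;> cases d <;> rfl

theorem turn_four (h : Bool) (d : Dir) : turn h (turn h (turn h (turn h d))) = d := by
  cases h <;> cases d <;> rfl

theorem dir_cases (h : Bool) (r d : Dir) :
    d = turn h r ∨ d = turn h (turn h r) ∨ d = turn h (turn h (turn h r)) ∨ d = r := by
  cases h <;> cases r <;> cases d <;> simp [turn]

theorem turn_ne (h : Bool) (r : Dir) : turn h r ≠ r := by
  cases h <;> cases r <;> simp [turn]

theorem turn_two_ne (h : Bool) (r : Dir) : turn h (turn h r) ≠ r := by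
  cases h <;> cases r <;> simp [turn]

theorem turn_three_ne (h : Bool) (r : Dir) : turn h (turn h (turn h r)) ≠ r := by
  cases h <;> cases r <;> simp [turn]

/-- The unit square (named by its lower left corner) that touches the edge `(v, d)` on its right
side for `true` and on its left side for `false`. -/
def side : Bool → ℤ × ℤ → Dir → ℤ × ℤ
  | true, v, .east => (v.1, v.2 - 1)
  | true, v, .north => (v.1, v.2)
  | true, v, .west => (v.1 - 1, v.2)
  | true, v, .south => (v.1 - 1, v.2 - 1)
  | false, v, .east => (v.1, v.2)
  | false, v, .north => (v.1 - 1, v.2)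
  | false, v, .west => (v.1 - 1, v.2 - 1)
  | false, v, .south => (v.1, v.2 - 1)

theorem side_opp (h : Bool) (v : ℤ × ℤ) (d : Dir) :
    side (!h) (v + d.vec) d.opp = side h v d := by
  cases h <;> cases d <;> simp [side, Dir.vec, Dir.opp, sub_eq_add_neg]

theorem side_opp' (h : Bool) (v : ℤ × ℤ) (d : Dir) :
    side h (v + d.vec) d.opp = side (!h) v d := by
  cases h <;> cases d <;> simp [side, Dir.vec, Dir.opp, sub_eq_add_neg]

theorem side_turn (h : Bool) (v : ℤ × ℤ) (d : Dir) :
    side h v (turn h d) = side (!h) v d := by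
  cases h <;> cases d <;> simp [side, turn]

theorem side_near (h : Bool) (v : ℤ × ℤ) (d : Dir) :
    v.1 - 1 ≤ (side h v d).1 ∧ (side h v d).1 ≤ v.1 ∧
      v.2 - 1 ≤ (side h v d).2 ∧ (side h v d).2 ≤ v.2 := by
  cases h <;> cases d <;> simp [side]

theorem add_vec_opp (v : ℤ × ℤ) (d : Dir) : v + d.vec + d.opp.vec = v := by
  rw [Dir.vec_opp, add_neg_cancel_right]

theorem vec_injective : Function.Injective Dir.vec := by
  intro a b h
  cases a <;> cases b <;> simp [Dir.vec] at h ⊢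

theorem opp_injective : Function.Injective Dir.opp := by
  intro a b h
  cases a <;> cases b <;> simp [Dir.opp] at h ⊢

theorem add_vec_ne (v : ℤ × ℤ) (d : Dir) : v + d.vec ≠ v := by
  intro h
  exact d.vec_ne_zero (by simpa using h)

/-! ### Winding numbers of closed lattice walks. -/

/-- The signed crossing of the step `(a, d)` with the horizontal ray that leaves the square `f`
towards the east. -/
def crossing (a : ℤ × ℤ) (d : Dir) (f : ℤ × ℤ) : ℤ :=
  match d with
  | .north => if a.2 = f.2 ∧ f.1 < a.1 then 1 else 0
  | .south => if a.2 = f.2 + 1 ∧ f.1 < a.1 then -1 else 0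
  | _ => 0

/-- How often the walk with vertices `c` and directions `δ` uses the edge `(v, d)` in its first
`N` steps. -/
def traversals (c : ℕ → ℤ × ℤ) (δ : ℕ → Dir) (N : ℕ) (v : ℤ × ℤ) (d : Dir) : ℤ :=
  ∑ i ∈ Finset.range N, if c i = v ∧ δ i = d then 1 else 0

/-- The winding number of the walk around the square `f`. -/
def winding (c : ℕ → ℤ × ℤ) (δ : ℕ → Dir) (N : ℕ) (f : ℤ × ℤ) : ℤ :=
  ∑ i ∈ Finset.range N, crossing (c i) (δ i) f

theorem traversals_eq_zero {c : ℕ → ℤ × ℤ} {δ : ℕ → Dir} {N : ℕ} {v : ℤ × ℤ} {d : Dir}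
    (h : ∀ i < N, c i = v → δ i ≠ d) : traversals c δ N v d = 0 :=
  Finset.sum_eq_zero fun i hi => by
    rw [if_neg]
    rintro ⟨h1, h2⟩
    exact h i (Finset.mem_range.1 hi) h1 h2

theorem traversals_pos {c : ℕ → ℤ × ℤ} {δ : ℕ → Dir} {N i : ℕ} {v : ℤ × ℤ} {d : Dir}
    (hi : i < N) (h1 : c i = v) (h2 : δ i = d) : 0 < traversals c δ N v d := by
  refine Finset.sum_pos' (fun i _ => by split_ifs <;> norm_num) ⟨i, Finset.mem_range.2 hi, ?_⟩
  rw [if_pos ⟨h1, h2⟩]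
  norm_num

theorem sum_telescope (g : ℕ → ℤ) (N : ℕ) :
    ∑ i ∈ Finset.range N, (g i - g (i + 1)) = g 0 - g N :=
  Finset.sum_range_sub' g N

/-- The two squares lie in adjacent rows. Apart from traversals of the edge, each step contributes
the change of the indicator `g` of the lattice row of `v` strictly east of `v`, and this telescopes
to zero because the walk is closed. -/
theorem winding_jump_east {c : ℕ → ℤ × ℤ} {δ : ℕ → Dir} {N : ℕ}
    (hc : ∀ i < N, c (i + 1) = c i + (δ i).vec) (hN : c N = c 0) (v : ℤ × ℤ) :
    winding c δ N (side false v .east) - winding c δ N (side true v .east) =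
      traversals c δ N v .east - traversals c δ N (v + Dir.vec .east) .west := by
  let g : ℕ → ℤ := fun i => if (c i).2 = v.2 ∧ v.1 < (c i).1 then 1 else 0
  have key : ∀ i < N, crossing (c i) (δ i) (side false v .east)
      - crossing (c i) (δ i) (side true v .east)
      - (if c i = v ∧ δ i = .east then 1 else 0)
      + (if c i = v + Dir.vec .east ∧ δ i = .west then 1 else 0) = g i - g (i + 1) := by
    intro i hi
    have h := hc i hi
    simp only [g, h]
    rcases hci : c i with ⟨a, b⟩
    rcases v with ⟨x, y⟩
    cases hd : δ i <;> simp [crossing, side, Dir.vec, Prod.ext_iff] <;> split_ifs <;>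
      omega
  have hs := Finset.sum_congr rfl fun i hi => key i (Finset.mem_range.1 hi)
  rw [sum_telescope, Finset.sum_add_distrib, Finset.sum_sub_distrib, Finset.sum_sub_distrib] at hs
  have : g 0 - g N = 0 := by simp [g, hN]
  simp only [winding, traversals]
  linarith

/-- Both squares lie in one row and their rays differ only by this edge, so the identity holds step
by step and the walk need not be closed. -/
theorem winding_jump_north {c : ℕ → ℤ × ℤ} {δ : ℕ → Dir} {N : ℕ} (v : ℤ × ℤ) :
    winding c δ N (side false v .north) - winding c δ N (side true v .north) =
      traversals c δ N v .north - traversals c δ N (v + Dir.vec .north) .south := by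
  simp only [winding, traversals, ← Finset.sum_sub_distrib]
  refine Finset.sum_congr rfl fun i _ => ?_
  rcases hci : c i with ⟨a, b⟩
  rcases v with ⟨x, y⟩
  cases hd : δ i <;> simp [crossing, side, Dir.vec, Prod.ext_iff] <;> split_ifs <;>
    omega

/-- The winding number jumps across an edge by the net number of traversals. -/
theorem winding_jump {c : ℕ → ℤ × ℤ} {δ : ℕ → Dir} {N : ℕ}
    (hc : ∀ i < N, c (i + 1) = c i + (δ i).vec) (hN : c N = c 0) (v : ℤ × ℤ) (d : Dir) :
    winding c δ N (side false v d) - winding c δ N (side true v d) =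
      traversals c δ N v d - traversals c δ N (v + d.vec) d.opp := by
  have rev : ∀ d' : Dir, d'.opp = d →
      (winding c δ N (side false (v + d.vec) d') - winding c δ N (side true (v + d.vec) d') =
        traversals c δ N (v + d.vec) d' - traversals c δ N (v + d.vec + d'.vec) d'.opp) →
      winding c δ N (side false v d) - winding c δ N (side true v d) =
        traversals c δ N v d - traversals c δ N (v + d.vec) d.opp := by
    intro d' hd' h
    have e : d' = d.opp := by rw [← hd', Dir.opp_opp]
    subst e
    rw [side_opp', side_opp', add_vec_opp, Dir.opp_opp] at h
    simp only [Bool.not_false, Bool.not_true] at h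
    linarith
  cases d with
  | east => exact winding_jump_east hc hN v
  | north => exact winding_jump_north v
  | west => exact rev .east rfl (winding_jump_east hc hN _)
  | south => exact rev .north rfl (winding_jump_north _)

/-- The winding number vanishes outside of every box that contains the walk. -/
theorem winding_box {c : ℕ → ℤ × ℤ} {δ : ℕ → Dir} {N : ℕ}
    (hc : ∀ i < N, c (i + 1) = c i + (δ i).vec) (hN : c N = c 0) {z : ℤ × ℤ} {M : ℤ}
    (hM : ∀ i ≤ N, |(c i).1 - z.1| ≤ M ∧ |(c i).2 - z.2| ≤ M) {f : ℤ × ℤ}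
    (hf : winding c δ N f ≠ 0) :
    (z.1 - M ≤ f.1 ∧ f.1 < z.1 + M) ∧ (z.2 - M ≤ f.2 ∧ f.2 < z.2 + M) := by
  by_contra hcon
  apply hf
  have hlo : f.1 < z.1 - M ∨ ¬ f.1 < z.1 - M := em _
  rcases hlo with hlo | hlo
  -- For a square west of the box the ray registers every step across its row, so the sum
  -- telescopes. In the remaining cases no step meets the ray.
  · let g : ℕ → ℤ := fun i => if f.2 < (c i).2 then -1 else 0
    have key : ∀ i < N, crossing (c i) (δ i) f = g i - g (i + 1) := by
      intro i hi
      have h := hc i hi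
      have h1 := (hM i hi.le).1
      rw [abs_le] at h1
      simp only [g, h]
      rcases hci : c i with ⟨a, b⟩
      rw [hci] at h1
      simp only at h1
      cases hd : δ i <;> simp [crossing, Dir.vec] <;> split_ifs <;> omega
    rw [winding, Finset.sum_congr rfl fun i hi => key i (Finset.mem_range.1 hi), sum_telescope]
    simp [g, hN]
  · refine Finset.sum_eq_zero fun i hi => ?_
    have hi := Finset.mem_range.1 hi
    have h := hM (i + 1) hi
    have h1 := hM i hi.le
    rw [hc i hi] at h
    rw [abs_le, abs_le] at h h1
    rcases hci : c i with ⟨a, b⟩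
    rw [hci] at h h1
    cases hd : δ i <;> simp [hd, Dir.vec] at h <;> simp [crossing] <;> intros <;> omega

/-! ### Bonds and separating points. -/

/-- A labelling of the lattice together with a symmetric set of edges, the bonds. -/
structure Bonds (Λ : Type*) where
  lab : ℤ × ℤ → Λ
  E : ℤ × ℤ → Dir → Prop
  symm : ∀ {v d}, E v d → E (v + d.vec) d.opp

namespace Bonds

variable {Λ : Type*} (B : Bonds Λ)

/-- The graph of the bonds. -/
def graph : SimpleGraph (ℤ × ℤ) where
  Adj u v := ∃ g, B.E u g ∧ v = u + g.vec
  symm := ⟨by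
    rintro u v ⟨g, h, rfl⟩
    exact ⟨g.opp, B.symm h, (add_vec_opp u g).symm⟩⟩
  loopless := ⟨by
    rintro u ⟨g, -, h⟩
    exact add_vec_ne u g h.symm⟩

/-- The points `u` and `v` are joined by a walk that avoids `z`. -/
def Off (z u v : ℤ × ℤ) : Prop := ∃ p : B.graph.Walk u v, z ∉ p.support

/-- The point `z` is different from `v` and separates it from the origin. -/
def Anc (z v : ℤ × ℤ) : Prop := v ≠ z ∧ ¬ B.Off z 0 v

variable {B} {u v w z z' : ℤ × ℤ} {g : Dir}

theorem adj_iff : B.graph.Adj u (u + g.vec) ↔ B.E u g := by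
  constructor
  · rintro ⟨g', h, e⟩
    have : g = g' := vec_injective (by simpa using e)
    rwa [this]
  · exact fun h => ⟨g, h, rfl⟩

theorem E_opp : B.E (v + g.vec) g.opp ↔ B.E v g := by
  refine ⟨fun h => ?_, B.symm⟩
  have := B.symm h
  rwa [add_vec_opp, Dir.opp_opp] at this

theorem Off.refl (h : u ≠ z) : B.Off z u u := ⟨.nil, by simpa using h.symm⟩

theorem Off.trans (h : B.Off z u v) (h' : B.Off z v w) : B.Off z u w := by
  obtain ⟨p, hp⟩ := h
  obtain ⟨q, hq⟩ := h'
  exact ⟨p.append q, by simp [SimpleGraph.Walk.mem_support_append_iff, hp, hq]⟩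

theorem Off.symm (h : B.Off z u v) : B.Off z v u := by
  obtain ⟨p, hp⟩ := h
  exact ⟨p.reverse, by simpa using hp⟩

theorem Off.of_adj (h : B.graph.Adj u v) (hu : u ≠ z) (hv : v ≠ z) : B.Off z u v :=
  ⟨.cons h .nil, by simp [hu.symm, hv.symm]⟩

theorem Off.left_ne (h : B.Off z u v) : u ≠ z := by
  obtain ⟨p, hp⟩ := h
  rintro rfl
  simp at hp

theorem Off.right_ne (h : B.Off z u v) : v ≠ z := h.symm.left_ne

theorem Off.of_walk {c : ℕ → ℤ × ℤ} {a b : ℕ} (hab : a ≤ b)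
    (hc : ∀ i, a ≤ i → i < b → B.graph.Adj (c i) (c (i + 1)))
    (hz : ∀ i, a ≤ i → i ≤ b → c i ≠ z) : B.Off z (c a) (c b) := by
  induction b, hab using Nat.le_induction with
  | base => exact .refl (hz a le_rfl le_rfl)
  | succ n hn ih =>
    exact (ih (fun i h1 h2 => hc i h1 (by omega)) (fun i h1 h2 => hz i h1 (by omega))).trans
      (.of_adj (hc n hn (by omega)) (hz n hn (by omega)) (hz _ (by omega) le_rfl))

/-- A first step of a walk out of `u` on which `u` is never visited again. -/
theorem exists_first_edge (h : B.graph.Reachable u v) (huv : u ≠ v) :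
    ∃ g, B.E u g ∧ B.Off u (u + g.vec) v := by
  classical
  obtain ⟨p, hp⟩ := h.exists_isPath
  cases p with
  | nil => exact absurd rfl huv
  | cons hadj q =>
    rw [SimpleGraph.Walk.cons_isPath_iff] at hp
    obtain ⟨g, hg, rfl⟩ := hadj
    exact ⟨g, hg, q, hp.2⟩

theorem not_anc_zero (z : ℤ × ℤ) : ¬ B.Anc z 0 := fun h => h.2 (.refl h.1)

theorem Anc.of_off (h : B.Anc z v) (huv : B.Off z u v) : B.Anc z u :=
  ⟨huv.left_ne, fun h0 => h.2 (h0.trans huv)⟩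

theorem not_anc_iff (h : v ≠ z) : ¬ B.Anc z v ↔ B.Off z 0 v := by
  simp [Anc, h]

theorem Anc.dist_lt (h : B.Anc z v) (hv : B.graph.Reachable 0 v) :
    B.graph.dist 0 z < B.graph.dist 0 v := by
  classical
  obtain ⟨p, hp⟩ := hv.exists_walk_length_eq_dist
  have hz : z ∈ p.support := by
    by_contra hz
    exact h.2 ⟨p, hz⟩
  rw [← hp]
  exact (SimpleGraph.dist_le (p.takeUntil z hz)).trans_lt
    (SimpleGraph.Walk.length_takeUntil_lt_length hz h.1.symm)

theorem Anc.reachable (h : B.Anc z v) (hv : B.graph.Reachable 0 v) : B.graph.Reachable 0 z := by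
  classical
  obtain ⟨p⟩ := hv
  have hz : z ∈ p.support := by
    by_contra hz
    exact h.2 ⟨p, hz⟩
  exact ⟨p.takeUntil z hz⟩

theorem Anc.asymm (h : B.Anc z v) (hv : B.graph.Reachable 0 v) : ¬ B.Anc v z := fun h' =>
  lt_asymm (h.dist_lt hv) (h'.dist_lt (h.reachable hv))

theorem Anc.trans (h : B.Anc u v) (h' : B.Anc v w) (hw : B.graph.Reachable 0 w) : B.Anc u w := by
  classical
  have hv := h'.reachable hw
  refine ⟨?_, ?_⟩
  · rintro rfl
    exact h.asymm hv h'
  · rintro ⟨p, hp⟩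
    have hz : v ∈ p.support := by
      by_contra hz
      exact h'.2 ⟨p, hz⟩
    exact h.2 ⟨p.takeUntil v hz, fun hu => hp (p.support_takeUntil_subset_support hz hu)⟩

/-- If neither separates the other, each is reachable from the origin avoiding the other. A simple
path to `v` passes `z'`. If it avoids `z` afterwards, this gives a route to `v` around `z`; if it
meets `z`, its rest after `z` gives a route around `z'`. -/
theorem Anc.total (h : B.Anc z v) (h' : B.Anc z' v) (hv : B.graph.Reachable 0 v) :
    z = z' ∨ B.Anc z z' ∨ B.Anc z' z := by
  classical
  by_contra! hcon
  obtain ⟨hne, h1, h2⟩ := hcon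
  rw [not_anc_iff hne.symm] at h1
  rw [not_anc_iff hne] at h2
  obtain ⟨p, hp⟩ := hv.exists_isPath
  have hz : z' ∈ p.support := by
    by_contra hz
    exact h'.2 ⟨p, hz⟩
  have hp1 := hp.dropUntil hz
  by_cases hz1 : z ∈ (p.dropUntil z' hz).support
  · refine h'.2 (h2.trans ⟨(p.dropUntil z' hz).dropUntil z hz1, fun hin => ?_⟩)
    have hcount := SimpleGraph.Walk.IsPath.support_nodup hp1
    rw [← SimpleGraph.Walk.take_spec (p.dropUntil z' hz) hz1,
      SimpleGraph.Walk.support_append, List.nodup_append] at hcount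
    have hin' : z' ∈ ((p.dropUntil z' hz).dropUntil z hz1).support.tail := by
      rw [SimpleGraph.Walk.mem_support_iff] at hin
      exact hin.resolve_left hne.symm
    exact hcount.2.2 z' (SimpleGraph.Walk.start_mem_support _) z' hin' rfl
  · exact h.2 (h1.trans ⟨_, hz1⟩)

theorem finite_anc (hv : B.graph.Reachable 0 v) : {z | B.Anc z v}.Finite := by
  obtain ⟨p⟩ := hv
  refine (List.finite_toSet p.support).subset fun z hz => ?_
  by_contra hz'
  exact hz.2 ⟨p, hz'⟩

variable (B) in
/-- The growth property of the maximal assembly of a confluent system: a neighbour that fits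
somewhere fits at every point with the same label, unless the place is taken by a point that
separates from the origin. -/
structure Growing : Prop where
  same : ∀ {u u' g}, B.E u g → B.lab u = B.lab u' → B.lab (u + g.vec) = B.lab (u' + g.vec) →
    B.E u' g
  grow : ∀ {u u' g}, B.E u g → B.lab u = B.lab u' → u + g.vec ≠ 0 →
    B.lab (u' + g.vec) = B.lab (u + g.vec) ∨ B.Anc (u' + g.vec) u'
  conn : ∀ {u g}, B.E u g → B.graph.Reachable 0 u

end Bonds

/-! ### Turning rules, and walkers with one hand on the wall. -/

open Classical in
/-- The first direction after `r`, turning as `h` says, at which `e` holds; `r` itself comes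
last. -/
noncomputable def firstFrom (h : Bool) (e : Dir → Prop) (r : Dir) : Dir :=
  if e (turn h r) then turn h r
  else if e (turn h (turn h r)) then turn h (turn h r)
  else if e (turn h (turn h (turn h r))) then turn h (turn h (turn h r))
  else r

/-- The direction `g` is passed over when one turns from `r` to the first direction in `e`. -/
def Skip (h : Bool) (e : Dir → Prop) (r g : Dir) : Prop :=
  ¬ e g ∧ (g = turn h r ∨ (g = turn h (turn h r) ∧ ¬ e (turn h r)) ∨
    (g = turn h (turn h (turn h r)) ∧ ¬ e (turn h r) ∧ ¬ e (turn h (turn h r))))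

section combinatorics

variable {h : Bool} {e e' : Dir → Prop} {r r' ρ g a : Dir}

theorem firstFrom_mem (he : e a) : e (firstFrom h e r) := by
  unfold firstFrom
  rcases dir_cases h r a with rfl | rfl | rfl | rfl <;> split_ifs <;> simp_all

/-- This makes the motion of a walker reversible: turning the other way from the exit recovers the
entrance, provided that the entrance is a bond. -/
theorem firstFrom_reverse (hr : e r) : firstFrom (!h) e (firstFrom h e r) = r := by
  unfold firstFrom
  cases h <;> cases r <;> by_cases h1 : e .east <;> by_cases h2 : e .north <;>
    by_cases h3 : e .west <;> by_cases h4 : e .south <;> simp_all [turn]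

theorem Skip.back_unique (h1 : Skip h e r g) (h2 : Skip h e r' g) (hr : e r) (hr' : e r') :
    r = r' := by
  unfold Skip at h1 h2
  cases h <;> cases r <;> cases r' <;> cases g <;> simp_all [turn]

theorem Skip.firstFrom_eq (h1 : Skip h e r g) (hr : e r) : firstFrom h e r = firstFrom h e g := by
  unfold Skip at h1
  unfold firstFrom
  cases h <;> cases r <;> cases g <;> by_cases h1 : e .east <;> by_cases h2 : e .north <;>
    by_cases h3 : e .west <;> by_cases h4 : e .south <;> simp_all [turn]

/-- The two turns that pass over the same direction lead to each other's starting points. -/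
theorem Skip.eq_firstFrom (h1 : Skip h e r g) (h2 : Skip (!h) e ρ g) (hr : e r) (hρ : e ρ) :
    ρ = firstFrom h e r := by
  unfold Skip at h1 h2
  unfold firstFrom
  cases h <;> cases r <;> cases ρ <;> cases g <;> by_cases h1 : e .east <;>
    by_cases h2 : e .north <;> by_cases h3 : e .west <;> by_cases h4 : e .south <;>
    simp_all [turn]

theorem skip_of_firstFrom_eq (hρ : e ρ) (ha : ¬ e a)
    (h1 : firstFrom h e ρ = firstFrom h e a) : Skip h e ρ a := by
  unfold Skip
  unfold firstFrom at h1
  cases h <;> cases ρ <;> cases a <;> by_cases h1 : e .east <;>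
    by_cases h2 : e .north <;> by_cases h3 : e .west <;> by_cases h4 : e .south <;>
    simp_all [turn]

/-- If the two exits differ, the one that comes first in turning order is passed over by the other
rule. So parallel walkers can only part where a bond of one is skipped by the other. -/
theorem firstFrom_eq_or_skip (h1 : e a) (h2 : e' ρ) :
    firstFrom h e r = firstFrom h e' r ∨ Skip h e r (firstFrom h e' r) ∨
      Skip h e' r (firstFrom h e r) := by
  have m1 := firstFrom_mem (h := h) (r := r) h1
  have m2 := firstFrom_mem (h := h) (r := r) h2
  revert m1 m2
  unfold Skip firstFrom
  have := turn_ne h r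
  have := turn_two_ne h r
  have := turn_three_ne h r
  split_ifs <;> simp_all

end combinatorics

namespace Bonds

variable {Λ : Type*} {B : Bonds Λ} {h : Bool} {w w' : ℕ → ℤ × ℤ} {r r' d d' : ℕ → Dir}

variable (B) in
/-- A walker that keeps one hand on the wall: at `w n`, having come from the direction `r n`, it
leaves in the next direction `d n` that is a bond. -/
structure IsWalker (h : Bool) (w : ℕ → ℤ × ℤ) (r d : ℕ → Dir) : Prop where
  out : ∀ n, d n = firstFrom h (B.E (w n)) (r n)
  pos : ∀ n, w (n + 1) = w n + (d n).vec
  back : ∀ n, r (n + 1) = (d n).opp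

variable (B) in
theorem exists_walker (h : Bool) (z : ℤ × ℤ) (ρ : Dir) :
    ∃ w r d, B.IsWalker h w r d ∧ w 0 = z ∧ r 0 = ρ := by
  let f : (ℤ × ℤ) × Dir → (ℤ × ℤ) × Dir := fun s =>
    (s.1 + (firstFrom h (B.E s.1) s.2).vec, (firstFrom h (B.E s.1) s.2).opp)
  refine ⟨fun n => (f^[n] (z, ρ)).1, fun n => (f^[n] (z, ρ)).2,
    fun n => firstFrom h (B.E (f^[n] (z, ρ)).1) (f^[n] (z, ρ)).2, ⟨fun n => rfl, fun n => ?_,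
      fun n => ?_⟩, rfl, rfl⟩
  · simp only [Function.iterate_succ_apply']
    rfl
  · simp only [Function.iterate_succ_apply']
    rfl

namespace IsWalker

theorem shift (H : B.IsWalker h w r d) (k : ℕ) :
    B.IsWalker h (fun n => w (k + n)) (fun n => r (k + n)) (fun n => d (k + n)) :=
  ⟨fun _ => H.out _, fun _ => H.pos _, fun _ => H.back _⟩

theorem d_eq (H : B.IsWalker h w r d) (H' : B.IsWalker h w' r' d') {i j : ℕ} (hw : w i = w' j)
    (hr : r i = r' j) : d i = d' j := by
  rw [H.out, H'.out, hw, hr]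

theorem unique (H : B.IsWalker h w r d) (H' : B.IsWalker h w' r' d') {i j : ℕ} (hw : w i = w' j)
    (hr : r i = r' j) (n : ℕ) : w (i + n) = w' (j + n) ∧ r (i + n) = r' (j + n) := by
  induction n with
  | zero => exact ⟨hw, hr⟩
  | succ n ih =>
    have := H.d_eq H' ih.1 ih.2
    rw [← add_assoc, ← add_assoc, H.pos, H'.pos, H.back, H'.back, this, ih.1]
    exact ⟨rfl, rfl⟩

theorem bond_out (H : B.IsWalker h w r d) {g : Dir} (h0 : B.E (w 0) g) (n : ℕ) :
    B.E (w n) (d n) := by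
  induction n with
  | zero => rw [H.out]; exact firstFrom_mem h0
  | succ n ih =>
    rw [H.out (n + 1)]
    refine firstFrom_mem (a := (d n).opp) ?_
    rw [H.pos]
    exact B.symm ih

theorem bond_back (H : B.IsWalker h w r d) {g : Dir} (h0 : B.E (w 0) g) (n : ℕ) :
    B.E (w (n + 1)) (r (n + 1)) := by
  rw [H.pos, H.back]
  exact B.symm (H.bond_out h0 n)

theorem bond_back' (H : B.IsWalker h w r d) (h0 : B.E (w 0) (r 0)) (n : ℕ) :
    B.E (w n) (r n) := by
  cases n with
  | zero => exact h0
  | succ n => exact H.bond_back h0 n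

theorem adj (H : B.IsWalker h w r d) {g : Dir} (h0 : B.E (w 0) g) (n : ℕ) :
    B.graph.Adj (w n) (w (n + 1)) := by
  rw [H.pos]
  exact adj_iff.2 (H.bond_out h0 n)

theorem off (H : B.IsWalker h w r d) {g : Dir} (h0 : B.E (w 0) g) {z : ℤ × ℤ} {a b : ℕ}
    (hab : a ≤ b) (hz : ∀ i, a ≤ i → i ≤ b → w i ≠ z) : B.Off z (w a) (w b) :=
  Off.of_walk hab (fun i _ _ => H.adj h0 i) hz

theorem reachable (H : B.IsWalker h w r d) {g : Dir} (h0 : B.E (w 0) g) (n : ℕ) :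
    B.graph.Reachable (w 0) (w n) := by
  induction n with
  | zero => exact .refl _
  | succ n ih => exact ih.trans (H.adj h0 n).reachable

/-- The previous state is determined by the state. -/
theorem back_step (H : B.IsWalker h w r d) (H' : B.IsWalker h w' r' d') {i j : ℕ}
    (hi : B.E (w i) (r i)) (hj : B.E (w' j) (r' j)) (hw : w (i + 1) = w' (j + 1))
    (hr : r (i + 1) = r' (j + 1)) : w i = w' j ∧ r i = r' j := by
  rw [H.back, H'.back] at hr
  have hd := opp_injective hr
  rw [H.pos, H'.pos, hd] at hw
  have hw := add_right_cancel hw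
  refine ⟨hw, ?_⟩
  rw [← firstFrom_reverse (h := h) hi, ← firstFrom_reverse (h := h) hj, ← H.out, ← H'.out, hd, hw]

/-- Reversibility pulls any repetition back to time 0: an orbit entered through a bond is either
purely periodic or never repeats a state. -/
theorem state_zero (H : B.IsWalker h w r d) (h0 : B.E (w 0) (r 0)) {i j : ℕ}
    (hw : w i = w (i + j)) (hr : r i = r (i + j)) : w 0 = w j ∧ r 0 = r j := by
  induction i with
  | zero => simpa using And.intro hw hr
  | succ i ih =>
    have := H.back_step H (H.bond_back' h0 i) (H.bond_back' h0 (i + j))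
      (by rw [hw]; congr 1; omega) (by rw [hr]; congr 1; omega)
    exact ih this.1 this.2

/-- Walkers that start at equal labels and meet no obstacle move in parallel. -/
theorem translate (hB : B.Growing) (H : B.IsWalker h w r d) (H' : B.IsWalker h w' r' d')
    {g g' : Dir} (h0 : B.E (w 0) g) (h0' : B.E (w' 0) g') (hl : B.lab (w 0) = B.lab (w' 0))
    (hr : r 0 = r' 0) (hne : ∀ n, w (n + 1) ≠ 0) (hne' : ∀ n, w' (n + 1) ≠ 0)
    (hu : ∀ n g, (g = d n ∨ Skip h (B.E (w n)) (r n) g) → ¬ B.Anc (w n + g.vec) (w 0))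
    (hu' : ∀ n g, (g = d' n ∨ Skip h (B.E (w' n)) (r' n) g) → ¬ B.Anc (w' n + g.vec) (w' 0))
    (n : ℕ) : w' n = w n + (w' 0 - w 0) ∧ r' n = r n ∧ B.lab (w' n) = B.lab (w n) := by
  -- A point that separates `w n` from the origin but not `w 0` must lie on the way from `w 0` to `w
  -- n`. Its label is then already known to be the translated one, so the exceptional case of `grow`
  -- does no harm.
  have visited : ∀ {w r d}, B.IsWalker h w r d → ∀ {g₀ : Dir}, B.E (w 0) g₀ → ∀ (n : ℕ)
      (g : Dir), ¬ B.Anc (w n + g.vec) (w 0) → B.Anc (w n + g.vec) (w n) →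
      ∃ i < n, w i = w n + g.vec := by
    intro w r d H g₀ h0 n g h1 h2
    by_contra! hcon
    refine h1 (h2.of_off (H.off h0 (Nat.zero_le n) fun i _ hi => ?_))
    rcases hi.lt_or_eq with hi | rfl
    · exact hcon i hi
    · exact (add_vec_ne _ _).symm
  induction n using Nat.strong_induction_on with
  | _ n ih =>
    cases n with
    | zero => exact ⟨by abel, hr.symm, hl.symm⟩
    | succ n =>
      obtain ⟨e1, e2, e3⟩ := ih n (by omega)
      have k1 : ∀ g, (g = d n ∨ Skip h (B.E (w n)) (r n) g) → B.E (w' n) g → w' n + g.vec ≠ 0 →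
          B.E (w n) g ∧ B.lab (w n + g.vec) = B.lab (w' n + g.vec) := by
        intro g hg hE hz
        have hlab : B.lab (w n + g.vec) = B.lab (w' n + g.vec) := by
          rcases hB.grow hE e3 hz with hlab | hA
          · exact hlab
          · obtain ⟨i, hi, hwi⟩ := visited H h0 n g (hu n g hg) hA
            obtain ⟨f1, -, f3⟩ := ih i (by omega)
            rw [← hwi, ← f3, f1, e1, hwi]
            congr 1
            abel
        exact ⟨hB.same hE e3 hlab.symm, hlab⟩
      have k2 : ∀ g, (g = d' n ∨ Skip h (B.E (w' n)) (r' n) g) → B.E (w n) g →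
          w n + g.vec ≠ 0 → B.E (w' n) g := by
        intro g hg hE hz
        have hlab : B.lab (w' n + g.vec) = B.lab (w n + g.vec) := by
          rcases hB.grow hE e3.symm hz with hlab | hA
          · exact hlab
          · obtain ⟨i, hi, hwi⟩ := visited H' h0' n g (hu' n g hg) hA
            obtain ⟨f1, -, f3⟩ := ih i (by omega)
            rw [← hwi, f3]
            congr 1
            have : w i + (w' 0 - w 0) = w n + (w' 0 - w 0) + g.vec := by rw [← f1, hwi, e1]
            rw [add_right_comm] at this
            exact add_right_cancel this
        exact hB.same hE e3.symm hlab.symm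
      have hd : d n = d' n := by
        rcases firstFrom_eq_or_skip (h := h) (r := r n) (H.bond_out h0 n) (H'.bond_out h0' n) with
          hf | hf | hf
        · rw [H.out, H'.out, hf, e2]
        · rw [← e2, ← H'.out] at hf
          exact absurd (k1 _ (.inr (e2 ▸ hf)) (H'.bond_out h0' n)
            (by rw [← H'.pos]; exact hne' n)).1
            hf.1
        · rw [← H.out, ← e2] at hf
          exact absurd (k2 _ (.inr hf) (H.bond_out h0 n) (by rw [← H.pos]; exact hne n)) hf.1
      refine ⟨?_, ?_, ?_⟩
      · rw [H.pos, H'.pos, e1, hd]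
        abel
      · rw [H.back, H'.back, hd]
      · rw [H.pos, H'.pos, ← hd]
        exact (k1 (d n) (.inl rfl) (hd ▸ H'.bond_out h0' n)
          (by rw [hd, ← H'.pos]; exact hne' n)).2.symm

end IsWalker

end Bonds

/-! ### The squares that a walker sees. -/

/-- The function `F` on the unit squares takes the same value on both sides of an edge. -/
def Flat (F : ℤ × ℤ → ℤ) (v : ℤ × ℤ) (g : Dir) : Prop := F (side true v g) = F (side false v g)

section faces

variable {F : ℤ × ℤ → ℤ} {v : ℤ × ℤ} {g g' r : Dir} {h : Bool} {e : Dir → Prop}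

theorem Flat.eq (hf : Flat F v g) (h h' : Bool) : F (side h v g) = F (side h' v g) := by
  cases h <;> cases h' <;> first | rfl | exact hf | exact Eq.symm hf

/-- All four squares at a point have the same value if all edges there are flat. -/
theorem flat_vertex (hf : ∀ g, Flat F v g) (h h' : Bool) (g g' : Dir) :
    F (side h v g) = F (side h' v g') := by
  have t : ∀ g, F (side true v (turn true g)) = F (side true v g) := fun g => by
    rw [side_turn]
    exact (hf g).symm
  rw [(hf g).eq h true, (hf g').eq h' true]
  rcases dir_cases true g g' with rfl | rfl | rfl | rfl <;> simp [t]

/-- Turning from entrance to exit sweeps over squares separated only by the skipped directions. Here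
and in `face_after` a jump is allowed at the single direction `g`, and the values on its two sides
are found; `face_const` is the case without a jump. -/
theorem face_before (hg : Skip h e r g) (hf : ∀ g', Skip h e r g' → g' ≠ g → Flat F v g') :
    F (side (!h) v r) = F (side h v g) := by
  obtain ⟨h0, rfl | ⟨rfl, h1⟩ | ⟨rfl, h1, h2⟩⟩ := hg
  · rw [side_turn]
  · rw [side_turn, ← (hf (turn h r) ⟨h1, .inl rfl⟩ (turn_ne h _).symm).eq h, side_turn]
  · rw [side_turn,
      ← (hf (turn h (turn h r)) ⟨h2, .inr (.inl ⟨rfl, h1⟩)⟩ (turn_ne h _).symm).eq h,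
      side_turn, ← (hf (turn h r) ⟨h1, .inl rfl⟩ (turn_two_ne h _).symm).eq h, side_turn]

theorem face_const (hf : ∀ g', Skip h e r g' → Flat F v g') :
    F (side (!h) v r) = F (side h v (firstFrom h e r)) := by
  unfold firstFrom
  split_ifs with h1 h2 h3
  · rw [side_turn]
  · rw [side_turn, ← (hf (turn h r) ⟨h1, .inl rfl⟩).eq h, side_turn]
  · rw [side_turn, ← (hf _ ⟨h2, .inr (.inl ⟨rfl, h1⟩)⟩).eq h, side_turn,
      ← (hf (turn h r) ⟨h1, .inl rfl⟩).eq h, side_turn]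
  · conv_rhs => rw [← turn_four h r]
    rw [side_turn, ← (hf _ ⟨h3, .inr (.inr ⟨rfl, h1, h2⟩)⟩).eq h, side_turn,
      ← (hf _ ⟨h2, .inr (.inl ⟨rfl, h1⟩)⟩).eq h, side_turn,
      ← (hf (turn h r) ⟨h1, .inl rfl⟩).eq h, side_turn]

theorem face_after (hg : Skip h e r g) (hf : ∀ g', Skip h e r g' → g' ≠ g → Flat F v g') :
    F (side (!h) v g) = F (side h v (firstFrom h e r)) := by
  have t3 := turn_ne h (turn h (turn h r))
  have t2 := turn_ne h (turn h r)
  have t1 := turn_two_ne h (turn h r)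
  obtain ⟨h0, rfl | ⟨rfl, h1⟩ | ⟨rfl, h1, h2⟩⟩ := hg
  · unfold firstFrom
    rw [if_neg h0]
    split_ifs with h2 h3
    · rw [side_turn]
    · rw [side_turn, ← (hf _ ⟨h2, .inr (.inl ⟨rfl, h0⟩)⟩ t2).eq h, side_turn]
    · conv_rhs => rw [← turn_four h r]
      rw [side_turn, ← (hf _ ⟨h3, .inr (.inr ⟨rfl, h0, h2⟩)⟩ t1).eq h, side_turn,
        ← (hf _ ⟨h2, .inr (.inl ⟨rfl, h0⟩)⟩ t2).eq h, side_turn]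
  · unfold firstFrom
    rw [if_neg h1, if_neg h0]
    split_ifs with h3
    · rw [side_turn]
    · conv_rhs => rw [← turn_four h r]
      rw [side_turn, ← (hf _ ⟨h3, .inr (.inr ⟨rfl, h1, h0⟩)⟩ t3).eq h, side_turn]
  · unfold firstFrom
    rw [if_neg h1, if_neg h2, if_neg h0]
    conv_rhs => rw [← turn_four h r]
    rw [side_turn]

end faces

section closed

/-- The edge `(v, g)` is used by the walk, in one of the two directions. -/
def Traversed (c : ℕ → ℤ × ℤ) (δ : ℕ → Dir) (N : ℕ) (v : ℤ × ℤ) (g : Dir) : Prop :=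
  (∃ i < N, c i = v ∧ δ i = g) ∨ ∃ i < N, c i = v + g.vec ∧ δ i = g.opp

variable {c : ℕ → ℤ × ℤ} {δ : ℕ → Dir} {N : ℕ} {v : ℤ × ℤ} {g : Dir}

theorem winding_flat (hc : ∀ i < N, c (i + 1) = c i + (δ i).vec) (hN : c N = c 0)
    (h : ¬ Traversed c δ N v g) : Flat (winding c δ N) v g := by
  have := winding_jump hc hN v g
  unfold Traversed at h
  push Not at h
  rw [traversals_eq_zero h.1, traversals_eq_zero h.2] at this
  unfold Flat
  linarith

theorem winding_not_flat (hc : ∀ i < N, c (i + 1) = c i + (δ i).vec) (hN : c N = c 0)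
    (h : Traversed c δ N v g) (h' : ¬ ∃ i < N, c i = v + g.vec ∧ δ i = g.opp) :
    ¬ Flat (winding c δ N) v g := by
  have := winding_jump hc hN v g
  obtain ⟨i, h1, h2, h3⟩ := h.resolve_right h'
  push Not at h'
  rw [traversals_eq_zero h'] at this
  have := traversals_pos (c := c) (δ := δ) h1 h2 h3
  unfold Flat
  omega

theorem not_traversed_of_forall_ne (hc : ∀ i < N, c (i + 1) = c i + (δ i).vec) (hN : c N = c 0)
    (h : ∀ i < N, c i ≠ v) : ¬ Traversed c δ N v g := by
  rintro (⟨i, h1, h2, -⟩ | ⟨i, h1, h2, h3⟩)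
  · exact h i h1 h2
  · have h4 := hc i h1
    rw [h2, h3, add_vec_opp] at h4
    rcases (Nat.succ_le_of_lt h1).lt_or_eq with h5 | h5
    · exact h _ h5 h4
    · rw [Nat.succ_eq_add_one] at h5
      rw [h5, hN] at h4
      exact h 0 (by omega) h4

theorem Traversed.opp : Traversed c δ N (v + g.vec) g.opp ↔ Traversed c δ N v g := by
  unfold Traversed
  rw [add_vec_opp, Dir.opp_opp]
  exact or_comm

end closed

namespace Bonds

variable {Λ : Type*} {B : Bonds Λ} {h : Bool} {w : ℕ → ℤ × ℤ} {r d : ℕ → Dir}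

/-- The last point of `S` on a walk that ends outside of `S`. -/
theorem exists_last_exit {S : Set (ℤ × ℤ)} {a v : ℤ × ℤ} (p : B.graph.Walk a v) (hv : v ∉ S)
    (hS : ∃ u ∈ p.support, u ∈ S) : ∃ u ∈ p.support, u ∈ S ∧ ∃ g, B.E u g ∧
      ∃ q : B.graph.Walk (u + g.vec) v, ∀ x ∈ q.support, x ∉ S := by
  induction p with
  | nil =>
    obtain ⟨u, hu, hu'⟩ := hS
    rw [SimpleGraph.Walk.support_nil, List.mem_singleton] at hu
    exact absurd (hu ▸ hu') hv
  | cons hadj q ih =>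
    by_cases hq : ∃ u ∈ q.support, u ∈ S
    · obtain ⟨u, h1, h2⟩ := ih hv hq
      exact ⟨u, by simp [h1], h2⟩
    · push Not at hq
      obtain ⟨u, hu, hu'⟩ := hS
      rw [SimpleGraph.Walk.support_cons, List.mem_cons] at hu
      rcases hu with rfl | hu
      · obtain ⟨g, hg, rfl⟩ := hadj
        exact ⟨_, by simp, hu', g, hg, q, hq⟩
      · exact absurd hu' (hq u hu)

/-- The four squares at a point with flat edges agree, and consecutive points of the walk share a
square. -/
theorem flat_walk {F : ℤ × ℤ → ℤ} {a v : ℤ × ℤ} (p : B.graph.Walk a v)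
    (hf : ∀ x ∈ p.support, ∀ g, Flat F x g) (h h' : Bool) (g g' : Dir) :
    F (side h a g) = F (side h' v g') := by
  induction p generalizing h g with
  | nil => exact flat_vertex (hf _ (by simp)) _ _ _ _
  | @cons a b c hadj q ih =>
    obtain ⟨k, hk⟩ : ∃ k : Dir, b = a + k.vec := by
      obtain ⟨k, -, hk⟩ := hadj
      exact ⟨k, hk⟩
    rw [← ih (fun x hx => hf x (by simp [hx])) true k.opp]
    subst hk
    rw [side_opp']
    exact flat_vertex (hf _ (by simp)) _ _ _ _

/-- There is no `t`-direction strictly between the entrance `firstFrom (!h) t g` and `g`, and the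
first `e`-direction after that entrance comes no later than `g`. -/
theorem untraversed_aux {h : Bool} {e t : Dir → Prop} {g : Dir} (hte : ∀ g, t g → e g)
    (hg : e g) (hg' : ¬ t g) :
    ¬ t (firstFrom h e (firstFrom (!h) t g)) := by
  unfold firstFrom
  have h1 := hte .east
  have h2 := hte .west
  have h3 := hte .north
  have h4 := hte .south
  cases h <;> cases g <;> by_cases t1 : t .east <;> by_cases t2 : t .north <;>
    by_cases t3 : t .west <;> by_cases t4 : t .south <;> simp_all [turn] <;> grind

namespace IsWalker

variable {N : ℕ}

theorem traversed_bond (H : B.IsWalker h w r d) {g₀ : Dir} (h0 : B.E (w 0) g₀) {v : ℤ × ℤ}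
    {g : Dir} (ht : Traversed w d N v g) : B.E v g := by
  rcases ht with ⟨i, -, rfl, rfl⟩ | ⟨i, -, h1, h2⟩
  · exact H.bond_out h0 i
  · have := H.bond_out h0 i
    rw [h1, h2] at this
    exact E_opp.1 this

/-- The squares next to a walker all have the same value. -/
theorem face_eq (H : B.IsWalker h w r d) {F : ℤ × ℤ → ℤ}
    (hf : ∀ n g, Skip h (B.E (w (n + 1))) (r (n + 1)) g → Flat F (w (n + 1)) g) (n : ℕ) :
    F (side h (w n) (d n)) = F (side h (w 0) (d 0)) := by
  induction n with
  | zero => rfl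
  | succ n ih =>
    rw [← ih, H.out (n + 1), ← face_const (hf n), H.pos, H.back, side_opp]

theorem closed_face_eq (H : B.IsWalker h w r d) {g₀ : Dir} (h0 : B.E (w 0) g₀)
    (hN : w N = w 0) (n : ℕ) :
    winding w d N (side h (w n) (d n)) = winding w d N (side h (w 0) (d 0)) :=
  H.face_eq (fun _ _ hs => winding_flat (fun i _ => H.pos i) hN fun ht =>
    hs.1 (H.traversed_bond h0 ht)) n

/-- Behind an untraversed bond the winding number of a closed walk differs from its value next to
the walk. -/
theorem untraversed (H : B.IsWalker h w r d) {g₀ : Dir} (h0 : B.E (w 0) g₀)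
    (hN : w N = w 0) {u : ℤ × ℤ} {g x : Dir}
    (hx : Traversed w d N u x)
    (hcl : ∀ i < N, w (i + 1) = u → r (i + 1) ≠ firstFrom (!h) (Traversed w d N u) g) :
    winding w d N (side h u g) ≠ winding w d N (side h (w 0) (d 0)) := by
  have hc : ∀ i < N, w (i + 1) = w i + (d i).vec := fun i _ => H.pos i
  have e1 := face_const (h := !h) (e := Traversed w d N u) (r := g) (v := u) fun g' hs =>
    winding_flat hc hN hs.1
  rw [Bool.not_not] at e1
  have hT := firstFrom_mem (h := !h) (r := g) hx
  set b := firstFrom (!h) (Traversed w d N u) g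
  -- The traversed direction `b` nearest to `g` is used only outwards, so the winding number really
  -- jumps there. One side of `b` is seen by the walker, the other side is joined to `g` by
  -- untraversed edges.
  have hin : ¬ ∃ i < N, w i = u + b.vec ∧ d i = b.opp := by
    rintro ⟨i, h1, h2, h3⟩
    refine hcl i h1 ?_ ?_
    · rw [hc i h1, h2, h3, add_vec_opp]
    · rw [H.back, h3, Dir.opp_opp]
  have hnf := winding_not_flat hc hN hT hin
  obtain ⟨i, -, h2, h3⟩ := hT.resolve_right hin
  rw [e1, ← H.closed_face_eq h0 hN i, h2, h3]
  intro hcon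
  apply hnf
  unfold Flat
  cases h
  · exact hcon
  · exact hcon.symm

/-- A walker arriving through the critical direction would leave by an untraversed edge
(`untraversed_aux`), which `hcl` excludes. -/
theorem untraversed' (H : B.IsWalker h w r d) {g₀ : Dir} (h0 : B.E (w 0) g₀)
    (hN : w N = w 0) {u : ℤ × ℤ} {g : Dir} (hg : B.E u g) (hg' : ¬ Traversed w d N u g)
    (hx : ∃ i < N, w i = u)
    (hcl : ∀ i < N, w (i + 1) = u → ∃ j < N, w j = u ∧ d j = d (i + 1)) :
    winding w d N (side h u g) ≠ winding w d N (side h (w 0) (d 0)) := by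
  obtain ⟨i, hi, hx⟩ := hx
  refine H.untraversed h0 hN (.inl ⟨i, hi, hx, rfl⟩) fun j hj h1 h2 => ?_
  refine untraversed_aux (h := h) (e := B.E u) (fun g ht => H.traversed_bond h0 ht) hg hg'
    (.inl ?_)
  rw [← h2, ← h1, ← H.out, h1]
  exact hcl j hj h1

end IsWalker

end Bonds

/-! ### Periodic walkers have bounded period. -/

namespace Bonds

variable {Λ : Type*} {B : Bonds Λ} {h : Bool} {w w' : ℕ → ℤ × ℤ} {r r' d d' : ℕ → Dir}

namespace IsWalker

variable {N : ℕ}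

theorem mod_period (H : B.IsWalker h w r d) (hw : w N = w 0) (hr : r N = r 0) (n : ℕ) :
    w n = w (n % N) ∧ r n = r (n % N) := by
  have key : ∀ k n, w (n + N * k) = w n ∧ r (n + N * k) = r n := by
    intro k n
    induction k with
    | zero => simp
    | succ k ih =>
      have := H.unique H (i := N) (j := 0) hw hr (n + N * k)
      rw [Nat.zero_add] at this
      rw [← ih.1, ← ih.2, ← this.1, ← this.2]
      constructor <;> (congr 1; ring)
  have := key (n / N) (n % N)
  rw [Nat.mod_add_div] at this
  exact this

/-- A periodic walker is not blocked by the ancestors of its lowest point. -/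
theorem root_unblocked (hB : B.Growing) (H : B.IsWalker h w r d) (h0 : B.E (w 0) (r 0))
    (hN : 0 < N) (hw : w N = w 0) (hr : r N = r 0)
    (hmin : ∀ n, B.graph.dist 0 (w 0) ≤ B.graph.dist 0 (w n)) (n : ℕ) (g : Dir)
    (hg : g = d n ∨ Skip h (B.E (w n)) (r n) g) : ¬ B.Anc (w n + g.vec) (w 0) := by
  intro hA
  have hreach : B.graph.Reachable 0 (w 0) := hB.conn h0
  have hS : ∀ m, w m ≠ w n + g.vec := by
    intro m hm
    rw [← hm] at hA
    exact absurd (hA.dist_lt hreach) (not_lt.2 (hmin m))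
  rcases hg with rfl | hs
  · exact hS (n + 1) (H.pos n)
  have hc : ∀ i < N, w (i + 1) = w i + (d i).vec := fun i _ => H.pos i
  have hfl : ∀ v, (∀ m, w m ≠ v) → ∀ g, Flat (winding w d N) v g := fun v hv g =>
    winding_flat hc hw (not_traversed_of_forall_ne hc hw fun i _ => hv i)
  have hfl' : ∀ m g, ¬ B.E (w m) g → Flat (winding w d N) (w m) g := fun m g hg =>
    winding_flat hc hw fun ht => hg (H.traversed_bond h0 ht)
  have e1 : winding w d N (side h (w n) g) = winding w d N (side h (w 0) (d 0)) := by
    rw [← face_before hs fun g' hs' _ => hfl' n g' hs'.1, face_const fun g' hs' => hfl' n g' hs'.1,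
      ← H.out, H.closed_face_eq h0 hw]
  obtain ⟨p⟩ := hreach.symm.trans (hA.reachable hreach)
  -- By `e1` the blocking point touches a square with the walker's own value. A path from the orbit
  -- to it leaves the orbit for the last time by an untraversed bond, where the value is different,
  -- and nothing changes the value from there on.
  obtain ⟨u, -, ⟨m, rfl⟩, g', hg', q, hq⟩ := exists_last_exit (S := {x | ∃ m, w m = x}) p
    (by rintro ⟨m, hm⟩; exact hS m hm) ⟨w 0, by simp, 0, rfl⟩
  have hq' : ∀ x ∈ q.support, ∀ g, Flat (winding w d N) x g := fun x hx =>
    hfl x fun m hm => hq x hx ⟨m, hm⟩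
  have ht : ¬ Traversed w d N (w m) g' := by
    rw [← Traversed.opp]
    exact not_traversed_of_forall_ne hc hw fun i _ hi => hq _ (by simp) ⟨i, hi⟩
  refine H.untraversed' h0 hw hg' ht ⟨m % N, Nat.mod_lt _ hN, (H.mod_period hw hr m).1.symm⟩
    (fun i _ hi => ⟨(i + 1) % N, Nat.mod_lt _ hN, ?_, ?_⟩) ?_
  · rw [← (H.mod_period hw hr _).1, hi]
  · have := H.mod_period hw hr (i + 1)
    exact H.d_eq H this.1.symm this.2.symm
  · rw [← e1, (hfl' n g hs.1).eq h (!h), ← side_opp h (w m) g', ← side_opp' h (w n) g]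
    exact flat_walk q hq' _ _ _ _

end IsWalker

/-- The finite orbits of walkers have bounded periods. -/
theorem Growing.exists_period_bound [Finite Λ] (hB : B.Growing) (h : Bool) :
    ∃ N₀, ∀ w r d, B.IsWalker h w r d → B.E (w 0) (r 0) →
      (∃ N, 0 < N ∧ w N = w 0 ∧ r N = r 0) → ∃ N, 0 < N ∧ N ≤ N₀ ∧ w N = w 0 ∧ r N = r 0 := by
  classical
  -- Closed orbits started at a point nearest to the origin are unblocked, so equal label and
  -- entrance make them translates with equal periods. The third entry sets apart orbits through the
  -- origin, where `grow` fails; there equal states give equal orbits.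
  have main : ∀ k : Λ × Dir × Prop, ∃ N, 0 < N ∧ ∀ w r d, B.IsWalker h w r d →
      B.E (w 0) (r 0) → (∃ N, 0 < N ∧ w N = w 0 ∧ r N = r 0) →
      (∀ n, B.graph.dist 0 (w 0) ≤ B.graph.dist 0 (w n)) →
      B.lab (w 0) = k.1 → r 0 = k.2.1 → (w 0 = 0) = k.2.2 → w N = w 0 ∧ r N = r 0 := by
    rintro ⟨l, ρ, P⟩
    by_cases hex : ∃ w r d, B.IsWalker h w r d ∧ B.E (w 0) (r 0) ∧
      (∃ N, 0 < N ∧ w N = w 0 ∧ r N = r 0) ∧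
      (∀ n, B.graph.dist 0 (w 0) ≤ B.graph.dist 0 (w n)) ∧
      B.lab (w 0) = l ∧ r 0 = ρ ∧ (w 0 = 0) = P
    · obtain ⟨w, r, d, H, h0, ⟨N, hN, hw, hr⟩, hmin, hl, hρ, hP⟩ := hex
      refine ⟨N, hN, ?_⟩
      rintro w' r' d' H' h0' ⟨N', hN', hw', hr'⟩ hmin' hl' hρ' hP'
      by_cases hz : w 0 = 0
      · have hz' : w' 0 = 0 := by rw [← eq_iff_iff.1 (hP.trans hP'.symm)]; exact hz
        have := H.unique H' (i := 0) (j := 0) (by rw [hz, hz']) (by rw [hρ, hρ']) N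
        rw [Nat.zero_add] at this
        rw [← this.1, ← this.2, hw, hr, hz, hz', hρ, hρ']
        exact ⟨rfl, rfl⟩
      · have hz' : w' 0 ≠ 0 := fun hh => hz ((eq_iff_iff.1 (hP.trans hP'.symm)).2 hh)
        have hne : ∀ {w : ℕ → ℤ × ℤ} {ρ}, B.E (w 0) ρ → w 0 ≠ 0 →
            (∀ n, B.graph.dist 0 (w 0) ≤ B.graph.dist 0 (w n)) → ∀ n, w n ≠ 0 := by
          intro w ρ h0 hz hmin n hn
          have := hmin n
          rw [hn, SimpleGraph.dist_self, Nat.le_zero] at this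
          exact hz (((hB.conn h0).dist_eq_zero_iff).1 this).symm
        have := H.translate hB H' h0 h0' (hl.trans hl'.symm) (hρ.trans hρ'.symm)
          (fun n => hne h0 hz hmin _) (fun n => hne h0' hz' hmin' _)
          (H.root_unblocked hB h0 hN hw hr hmin) (H'.root_unblocked hB h0' hN' hw' hr' hmin') N
        rw [this.1, this.2.1, hw, hr, hρ, hρ']
        exact ⟨by abel, rfl⟩
    · refine ⟨1, one_pos, fun w r d h1 h2 h3 h4 h5 h6 h7 => absurd ?_ hex⟩
      exact ⟨w, r, d, h1, h2, h3, h4, h5, h6, h7⟩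
  choose P hP hP' using main
  obtain ⟨N₀, hN₀⟩ := (Set.finite_range P).bddAbove
  refine ⟨N₀, fun w r d H h0 ⟨N, hN, hw, hr⟩ => ?_⟩
  obtain ⟨i, hi⟩ : ∃ i, ∀ n, B.graph.dist 0 (w i) ≤ B.graph.dist 0 (w n) :=
    ⟨_, fun n => Function.argmin_le (fun n => B.graph.dist 0 (w n)) n⟩
  refine ⟨P (B.lab (w i), r i, w i = 0), hP _, hN₀ ⟨_, rfl⟩, ?_⟩
  have h1 := H.unique H (i := N) (j := 0) hw hr
  have h2 := hP' (B.lab (w i), r i, w i = 0) _ _ _ (H.shift i) (H.bond_back' h0 i)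
    ⟨N, hN, ?_, ?_⟩ (fun n => hi _) rfl rfl rfl
  · obtain ⟨h3, h4⟩ := H.state_zero h0 h2.1.symm h2.2.symm
    exact ⟨h3.symm, h4.symm⟩
  · have := (h1 i).1
    rwa [Nat.zero_add, Nat.add_comm] at this
  · have := (h1 i).2
    rwa [Nat.zero_add, Nat.add_comm] at this

end Bonds

/-! ### A walker whose states never repeat. -/

theorem exists_infinite_fiber {α β : Type*} {S : Set α} {D : Set β} (hS : S.Infinite)
    (hD : D.Finite) {R : β → α → Prop} (h : ∀ v ∈ S, ∃ y ∈ D, R y v) :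
    ∃ y ∈ D, {v ∈ S | R y v}.Infinite := by
  by_contra! hcon
  refine hS ((hD.biUnion hcon).subset fun v hv => ?_)
  obtain ⟨y, hy, hR⟩ := h v hv
  exact Set.mem_biUnion hy ⟨hv, hR⟩

/-- The square box of radius `M` around `z`. -/
noncomputable def box (z : ℤ × ℤ) (M : ℕ) : Finset (ℤ × ℤ) :=
  Finset.Icc (z.1 - M) (z.1 + M) ×ˢ Finset.Icc (z.2 - M) (z.2 + M)

theorem mem_box {z v : ℤ × ℤ} {M : ℕ} :
    v ∈ box z M ↔ |v.1 - z.1| ≤ M ∧ |v.2 - z.2| ≤ M := by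
  simp only [box, Finset.mem_product, Finset.mem_Icc, abs_le]
  omega

theorem card_box (z : ℤ × ℤ) (M : ℕ) : (box z M).card = (2 * M + 1) * (2 * M + 1) := by
  rw [box, Finset.card_product, Int.card_Icc, Int.card_Icc]
  congr 1 <;> omega

theorem add_vec_mem_box {z v : ℤ × ℤ} {M : ℕ} (hv : v ∈ box z M) (d : Dir) :
    v + d.vec ∈ box z (M + 1) := by
  rw [mem_box, abs_le, abs_le] at hv ⊢
  cases d <;> simp [Dir.vec] <;> omega

theorem mem_box_of_steps {c : ℕ → ℤ × ℤ} {δ : ℕ → Dir} (hc : ∀ i, c (i + 1) = c i + (δ i).vec)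
    (n : ℕ) : c n ∈ box (c 0) n := by
  induction n with
  | zero => simp [mem_box]
  | succ n ih => rw [hc]; exact add_vec_mem_box ih _

theorem box_mono {z : ℤ × ℤ} {M M' : ℕ} (h : M ≤ M') : box z M ⊆ box z M' := by
  intro v hv
  rw [mem_box] at hv ⊢
  constructor <;> [refine hv.1.trans ?_; refine hv.2.trans ?_] <;> exact_mod_cast h

/-- A point next to a square with non-zero winding number lies near every box that contains the
walk. -/
theorem winding_near {c : ℕ → ℤ × ℤ} {δ : ℕ → Dir} {N : ℕ}
    (hc : ∀ i < N, c (i + 1) = c i + (δ i).vec) (hN : c N = c 0) {z v : ℤ × ℤ} {M : ℕ}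
    (hM : ∀ i ≤ N, c i ∈ box z M) {h : Bool} {g : Dir} (hv : winding c δ N (side h v g) ≠ 0) :
    v ∈ box z (M + 1) := by
  have := winding_box hc hN (fun i hi => mem_box.1 (hM i hi)) hv
  have h2 := side_near h v g
  rw [mem_box, abs_le, abs_le]
  push_cast
  omega

namespace Bonds

variable {Λ : Type*} {B : Bonds Λ}

variable (B) in
/-- The points that are reached through `z`. -/
def below (z : ℤ × ℤ) : Set (ℤ × ℤ) := {v | B.graph.Reachable 0 v ∧ B.Anc z v}

variable (B) in
/-- Every finite set bounds the ancestors of only finitely many points. -/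
def Deep : Prop := ∀ Z : Set (ℤ × ℤ), Z.Finite →
  {v | B.graph.Reachable 0 v ∧ ∀ z, B.Anc z v → z ∈ Z}.Finite

theorem exists_minimal_anc {v : ℤ × ℤ} {Z : Set (ℤ × ℤ)} (hv : B.graph.Reachable 0 v)
    (h : ∃ y, B.Anc y v ∧ y ∉ Z) : ∃ y, B.Anc y v ∧ y ∉ Z ∧ ∀ x, B.Anc x y → x ∈ Z := by
  obtain ⟨y₀, hy₀⟩ := h
  obtain ⟨y, ⟨hy1, hy2⟩, hmin⟩ := exists_minimalFor_of_wellFoundedLT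
    (fun y => B.Anc y v ∧ y ∉ Z) (fun y => B.graph.dist 0 y) ⟨y₀, hy₀⟩
  refine ⟨y, hy1, hy2, fun x hx => ?_⟩
  by_contra hx'
  have := hmin (j := x) ⟨hx.trans hy1 hv, hx'⟩ (hx.dist_lt (hy1.reachable hv)).le
  exact absurd (hx.dist_lt (hy1.reachable hv)) (not_lt.2 this)

/-- Almost all points below `z` have an ancestor other than `z` and its ancestors. A minimal one
lies below `z` and in a set that is finite by `Deep`, so one such point is shared by infinitely
many, and it has `z` as an additional ancestor. -/
theorem Deep.exists_below_infinite (hA : B.Deep) (hinf : {v | B.graph.Reachable 0 v}.Infinite)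
    (K : ℕ) : ∃ z, B.graph.Reachable 0 z ∧ (B.below z).Infinite ∧ K ≤ {x | B.Anc x z}.ncard := by
  induction K with
  | zero =>
    refine ⟨0, .refl _, fun hfin => hinf ((hfin.insert 0).subset fun v hv => ?_), Nat.zero_le _⟩
    by_cases h : v = 0
    · exact .inl h
    · exact .inr ⟨hv, h, fun ho => ho.left_ne rfl⟩
  | succ K ih =>
    obtain ⟨z, hz, hY, hK⟩ := ih
    have hfz := finite_anc hz
    have hD := hA _ (hfz.insert z)
    obtain ⟨y, ⟨hy, -⟩, hy'⟩ := exists_infinite_fiber (hY.sdiff hD) hD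
        (R := fun y v => B.Anc z y ∧ B.Anc y v) (by
      rintro v ⟨⟨hv, hzv⟩, hvD⟩
      simp only [Set.mem_ofPred_eq, not_and, not_forall, exists_prop] at hvD
      obtain ⟨y, hy1, hy2, hy3⟩ := exists_minimal_anc hv (hvD hv)
      refine ⟨y, ⟨hy1.reachable hv, hy3⟩, ?_, hy1⟩
      · rcases hzv.total hy1 hv with rfl | h | h
        · simp at hy2
        · exact h
        · exact absurd (.inr h) hy2)
    obtain ⟨v, ⟨-, hzy, -⟩⟩ := hy'.nonempty
    refine ⟨y, hy, hy'.mono fun v hv => ⟨hv.1.1.1, hv.2.2⟩, ?_⟩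
    rw [← Nat.succ_eq_add_one, Nat.succ_le_iff]
    refine hK.trans_lt (Set.ncard_lt_ncard ⟨fun x hx => Anc.trans hx hzy hy, fun hsub => ?_⟩
      (finite_anc hy))
    exact (hsub hzy : B.Anc z z).1 rfl

/-- Counterclockwise from the last `c`-direction before `g`, the first exit is in `t` and comes
before `g`. So the last `t`-direction before `g` lies in the `c`-free sector, and the next exit
after it still comes no later than `g`. -/
theorem enclosed_aux {e t c : Dir → Prop} {g : Dir}
    (hce : ∀ g, c g → e g) (hct : ∀ g, t g → ¬ c g) (hg : e g) (hg' : ¬ t g) (hgc : ¬ c g)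
    (h1 : c (firstFrom false c g)) (h2 : t (firstFrom true e (firstFrom false c g))) :
    ¬ c (firstFrom true e (firstFrom false t g)) := by
  unfold firstFrom at *
  cases g <;> simp only [turn] at * <;> grind

theorem first_step_aux {e c : Dir → Prop} {g : Dir} (hg : e g)
    (hgc : ¬ c g) (h1 : c (firstFrom false c g)) :
    ¬ c (firstFrom true e (firstFrom false c g)) := by
  unfold firstFrom at *
  cases g <;> simp only [turn] at * <;> grind

/-- There is a walker whose states never repeat. -/
theorem Deep.exists_walker_injective [Finite Λ] (hB : B.Growing) (hA : B.Deep)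
    (hinf : {v | B.graph.Reachable 0 v}.Infinite) :
    ∃ w r d, B.IsWalker true w r d ∧ B.E (w 0) (r 0) ∧
      ∀ i j, w i = w j → r i = r j → i = j := by
  obtain ⟨N₀, hN₀⟩ := hB.exists_period_bound true
  -- The number of ancestors exceeds the size of the box that would have to contain them if the
  -- walker were periodic.
  obtain ⟨z, hz, hY, hK⟩ :=
    hA.exists_below_infinite hinf ((box (0 : ℤ × ℤ) (N₀ + 1)).card + 1)
  obtain ⟨g0, -, hg0⟩ := exists_infinite_fiber hY (Set.finite_univ (α := Dir))
      (R := fun g v => B.E z g ∧ B.Off z (z + g.vec) v) (by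
    rintro v ⟨hv, hzv⟩
    obtain ⟨g, h1, h2⟩ := exists_first_edge (hz.symm.trans hv) hzv.1.symm
    exact ⟨g, trivial, h1, h2⟩)
  obtain ⟨v₀, ⟨-, hzv₀⟩, hEg0, hoff₀⟩ := hg0.nonempty
  have hg0Y : B.Anc z (z + g0.vec) := hzv₀.of_off hoff₀
  -- These bonds lead from `z` to the side of the origin. The walker enters through the last of them
  -- before `g0` in turning order, so that it first explores what is below `z`.
  let C : Dir → Prop := fun g => B.E z g ∧ ¬ B.Anc z (z + g.vec)
  have hCE : ∀ g, C g → B.E z g := fun g h => h.1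
  have hz0 : z ≠ 0 := by
    rintro rfl
    have : {x | B.Anc x 0} = ∅ := by
      ext x
      simp [not_anc_zero]
    rw [this, Set.ncard_empty] at hK
    omega
  obtain ⟨gC, hgC⟩ : ∃ g, C g := by
    obtain ⟨g, h1, h2⟩ := exists_first_edge hz.symm hz0
    exact ⟨g, h1, fun h => h.2 h2.symm⟩
  have hCg0 : ¬ C g0 := fun h => h.2 hg0Y
  have hCe : C (firstFrom false C g0) := firstFrom_mem hgC
  obtain ⟨w, r, d, H, hw0, hr0⟩ := B.exists_walker true z (firstFrom false C g0)
  have h0 : B.E (w 0) (r 0) := by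
    rw [hw0, hr0]
    exact hCE _ hCe
  -- as long as the walker does not take an edge of `C` it stays below `z`
  have stay : ∀ N, (∀ i < N, w i = z → ¬ C (d i)) → ∀ i ≤ N, w i = z ∨ B.Anc z (w i) := by
    intro N hN i hi
    induction i with
    | zero => exact .inl hw0
    | succ i ih =>
      rcases eq_or_ne (w (i + 1)) z with h | h
      · exact .inl h
      rcases ih (by omega) with h' | h'
      · have := hN i (by omega) h'
        right
        by_contra hcon
        rw [H.pos, h'] at hcon
        exact this ⟨by rw [← h']; exact H.bond_out h0 i, hcon⟩
      · exact .inr (h'.of_off (Off.of_adj (H.adj h0 i) h'.1 h).symm)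
  have never : ∀ N, w N = z → ¬ C (d N) := by
    intro N
    induction N using Nat.strong_induction_on with
    | _ N hmin =>
    intro hNz hCd
    have hYS := stay N hmin
    have hw : w N = w 0 := hNz.trans hw0.symm
    have hN : 0 < N := by
      rw [Nat.pos_iff_ne_zero]
      rintro rfl
      rw [H.out, hr0, hw0] at hCd
      exact first_step_aux hEg0 hCg0 hCe hCd
    have hc : ∀ i < N, w (i + 1) = w i + (d i).vec := fun i _ => H.pos i
    let S : Set (ℤ × ℤ) := {x | ∃ i < N, w i = x}
    have hS : ∀ x ∉ S, ∀ g, Flat (winding w d N) x g := fun x hx g =>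
      winding_flat hc hw (not_traversed_of_forall_ne hc hw fun i hi h => hx ⟨i, hi, h⟩)
    have hSY : ∀ x ∈ S, x = z ∨ B.Anc z x := by
      rintro x ⟨i, hi, rfl⟩
      exact hYS i hi.le
    have hTS : ∀ u g, u + g.vec ∉ S → ¬ Traversed w d N u g := by
      intro u g hu
      rw [← Traversed.opp]
      exact not_traversed_of_forall_ne hc hw fun i hi h => hu ⟨i, hi, h⟩
    set c := winding w d N (side true (w 0) (d 0)) with hcdef
    have hcface := H.closed_face_eq h0 hw
    -- the squares at the points that are not below `z`
    have hCc : ∀ x, x ≠ z → B.graph.Reachable 0 x → ¬ B.Anc z x → ∀ h g,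
        winding w d N (side h x g) = c := by
      intro x hxz hx hxA h g
      have hd : z + (d N).vec ≠ z := add_vec_ne _ _
      have h1 := (not_anc_iff hd).1 hCd.2
      obtain ⟨q, hq⟩ := h1.symm.trans ((not_anc_iff hxz).1 hxA)
      have hq' : ∀ y ∈ q.support, y ∉ S := by
        classical
        intro y hy hyS
        rcases hSY y hyS with rfl | hyA
        · exact hq hy
        · exact hCd.2 (hyA.of_off ⟨q.takeUntil y hy, fun h => hq
            (q.support_takeUntil_subset_support hy h)⟩)
      rw [← flat_walk q (fun y hy => hS y (hq' y hy)) false h (d N).opp g, side_opp', ← hNz]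
      exact hcface N
    -- far away below `z` the winding number vanishes
    have hc0 : c ≠ 0 := by
      obtain ⟨v, ⟨⟨hv, hzv⟩, -, hov⟩, hvbox⟩ := (hg0.sdiff (box z (N + 1)).finite_toSet).nonempty
      have hbox : ∀ i ≤ N, w i ∈ box z N := fun i hi => by
        rw [← hw0]
        exact box_mono hi (mem_box_of_steps H.pos i)
      have hvS : v ∉ S := by
        rintro ⟨i, hi, rfl⟩
        exact hvbox (box_mono (Nat.le_succ N) (hbox i hi.le))
      have hv0 : winding w d N (side true v .east) = 0 := by
        by_contra hne
        exact hvbox (winding_near hc hw hbox hne)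
      rw [← hv0]
      obtain ⟨p, hp⟩ := hov
      by_cases hpS : ∃ u ∈ p.support, u ∈ S
      · obtain ⟨u, hu, hu', g, hg, q, hq⟩ := exists_last_exit p hvS hpS
        have huz : u ≠ z := fun h => hp (h ▸ hu)
        have hq' := flat_walk q (fun y hy => hS y (hq y hy)) false true g.opp .east
        rw [side_opp'] at hq'
        rw [← hq']
        refine (H.untraversed' h0 hw hg (hTS u g (hq _ (by simp))) hu' fun i hi hiu => ?_).symm
        rcases (Nat.succ_le_of_lt hi).lt_or_eq with h | h
        · exact ⟨i + 1, h, hiu, rfl⟩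
        · rw [Nat.succ_eq_add_one] at h
          rw [h, hNz] at hiu
          exact absurd hiu.symm huz
      · push Not at hpS
        have hp' := flat_walk p (fun y hy => hS y (hpS y hy)) false true g0.opp .east
        rw [side_opp'] at hp'
        rw [← hp']
        have hnt := hTS z g0 (hpS _ (by simp))
        have ht0 : Traversed w d N z (d 0) := .inl ⟨0, hN, hw0, rfl⟩
        have htE : ∀ g, Traversed w d N z g → B.E z g := fun g => H.traversed_bond h0
        refine (H.untraversed h0 hw ht0 fun i hi h1 h2 => ?_).symm
        have hdi : d (i + 1) =
            firstFrom true (B.E z) (firstFrom false (Traversed w d N z) g0) := by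
          rw [H.out, h1, h2]
          rfl
        rcases (Nat.succ_le_of_lt hi).lt_or_eq with h | h
        · refine untraversed_aux (h := true) htE hEg0 hnt ?_
          rw [Bool.not_true, ← hdi]
          exact .inl ⟨i + 1, h, h1, rfl⟩
        · rw [Nat.succ_eq_add_one] at h
          refine enclosed_aux (g := g0) (e := B.E z) (t := Traversed w d N z) (c := C) hCE ?_ hEg0
            hnt hCg0 hCe ?_ ?_
          · rintro g (⟨j, hj, h3, rfl⟩ | ⟨j, hj, h3, -⟩) hCg
            · exact hmin j hj h3 hCg
            · rcases hYS j hj.le with h4 | h4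
              · exact add_vec_ne z g (h3.symm.trans h4)
              · rw [h3] at h4
                exact hCg.2 h4
          · have := H.out 0
            rw [hw0, hr0] at this
            rw [← this]
            exact ht0
          · rw [← hdi, h]
            exact hCd
    -- hence the walker is caught in a box, and so is everything that is not below `z`
    have hall : ∀ n, w n ∈ box z (N + 1) := fun n =>
      winding_near hc hw (fun i hi => by
        rw [← hw0]
        exact box_mono hi (mem_box_of_steps H.pos i)) ((hcface n).trans_ne hc0)
    obtain ⟨i, j, hij, hwij, hrij⟩ : ∃ i j, i < j ∧ w i = w j ∧ r i = r j := by
      have hfin : ((box z (N + 1) : Set (ℤ × ℤ)) ×ˢ (Set.univ : Set Dir)).Finite :=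
        (box z (N + 1)).finite_toSet.prod Set.finite_univ
      obtain ⟨i, -, j, -, hij, h⟩ := (Set.infinite_univ (α := ℕ)).exists_lt_map_eq_of_mapsTo
        (f := fun n => (w n, r n)) (fun n _ => Set.mk_mem_prod (hall n) (Set.mem_univ _)) hfin
      exact ⟨i, j, hij, (Prod.ext_iff.1 h).1, (Prod.ext_iff.1 h).2⟩
    obtain ⟨k, rfl⟩ := Nat.exists_eq_add_of_le hij.le
    have hk := H.state_zero h0 hwij hrij
    obtain ⟨P, hP, hPN, hPw, hPr⟩ := hN₀ w r d H h0 ⟨k, by omega, hk.1.symm, hk.2.symm⟩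
    have hall' : ∀ n, w n ∈ box z N₀ := fun n => by
      rw [(H.mod_period hPw hPr n).1, ← hw0]
      exact box_mono ((Nat.mod_lt _ hP).le.trans hPN) (mem_box_of_steps H.pos _)
    have hsub : {x | B.Anc x z} ⊆ (box z (N₀ + 1) : Set (ℤ × ℤ)) := by
      intro x hx
      have h1 := hCc x hx.1.symm (hx.reachable hz) (hx.asymm hz) true .east
      exact winding_near hc hw (fun i _ => hall' i) (h1.trans_ne hc0)
    have := Set.ncard_le_ncard hsub (Finset.finite_toSet _)
    rw [Set.ncard_coe_finset, card_box] at this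
    rw [card_box] at hK
    omega
  have stay' : ∀ n, w n = z ∨ B.Anc z (w n) := fun n => stay n (fun i _ => never i) n le_rfl
  refine ⟨w, r, d, H, h0, ?_⟩
  have key : ∀ k, w 0 = w k → r 0 = r k → k = 0 := by
    intro k h1 h2
    cases k with
    | zero => rfl
    | succ k =>
      exfalso
      have hb : w k = z + (firstFrom false C g0).vec := by
        rw [← hr0, h2, H.back, ← hw0, h1, H.pos, add_vec_opp]
      rcases stay' k with h | h
      · exact add_vec_ne _ _ (hb.symm.trans h)
      · rw [hb] at h
        exact hCe.2 h
  intro i j hw hr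
  rcases le_total i j with hij | hij <;> obtain ⟨k, rfl⟩ := Nat.exists_eq_add_of_le hij
  · obtain ⟨h1, h2⟩ := H.state_zero h0 hw hr
    rw [key k h1 h2, Nat.add_zero]
  · obtain ⟨h1, h2⟩ := H.state_zero h0 hw.symm hr.symm
    rw [key k h1 h2, Nat.add_zero]

end Bonds

/-! ### Chords: closing a walk by an edge that is not a bond. -/

namespace Bonds

variable {Λ : Type*} {B : Bonds Λ} {h : Bool} {w w' : ℕ → ℤ × ℤ} {r r' d d' : ℕ → Dir}

variable (B) in
/-- Apart from bonds, the function `F` jumps at most across the edge `(y, g)`. -/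
def IsChord (F : ℤ × ℤ → ℤ) (y : ℤ × ℤ) (g : Dir) : Prop :=
  ∀ v g', ¬ B.E v g' → ¬ (v = y ∧ g' = g) → ¬ (v = y + g.vec ∧ g' = g.opp) → Flat F v g'

theorem IsChord.symm {F : ℤ × ℤ → ℤ} {y : ℤ × ℤ} {g : Dir} (hF : B.IsChord F y g) :
    B.IsChord F (y + g.vec) g.opp := by
  intro v g' h1 h2 h3
  rw [add_vec_opp, Dir.opp_opp] at h3
  exact hF v g' h1 h3 h2

namespace IsWalker

/-- The winding number of a piece of a walk that is closed up by an edge that is not a bond. -/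
theorem exists_chord (H : B.IsWalker h w r d) {g₀ : Dir} (h0 : B.E (w 0) g₀) {q m : ℕ} {g : Dir}
    (hqm : q ≤ m) (hq : w q = w m + g.vec) (hg : ¬ B.E (w m) g) :
    ∃ F, B.IsChord F (w m) g ∧ F (side false (w m) g) = F (side true (w m) g) + 1 ∧
      (∀ v, (∀ i, q ≤ i → i ≤ m → w i ≠ v) → ∀ g', Flat F v g') ∧
      ∃ M, ∀ v h' g', F (side h' v g') ≠ 0 → v ∈ box (w q) M := by
  obtain ⟨L, rfl⟩ := Nat.exists_eq_add_of_le hqm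
  -- The closed walk takes `L` steps of the walker and then the chord; `F` is its winding number, so
  -- there are `L + 1` steps.
  let c : ℕ → ℤ × ℤ := fun i => if i ≤ L then w (q + i) else w q
  let δ : ℕ → Dir := fun i => if i < L then d (q + i) else g
  have c_le : ∀ i ≤ L, c i = w (q + i) := fun i hi => if_pos hi
  have c_last : c (L + 1) = w q := if_neg (by omega)
  have δ_lt : ∀ i < L, δ i = d (q + i) := fun i hi => if_pos hi
  have δ_last : δ L = g := if_neg (lt_irrefl L)
  have hc : ∀ i < L + 1, c (i + 1) = c i + (δ i).vec := by
    intro i hi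
    rcases (Nat.lt_succ_iff.1 hi).lt_or_eq with hi | rfl
    · rw [c_le i hi.le, c_le (i + 1) hi, δ_lt i hi, ← Nat.add_assoc, H.pos]
    · rw [c_last, c_le i le_rfl, δ_last, hq]
  have hN : c (L + 1) = c 0 := by rw [c_last, c_le 0 (Nat.zero_le _), Nat.add_zero]
  have hT : ∀ {v g'}, Traversed c δ (L + 1) v g' → B.E v g' ∨ (v = w (q + L) ∧ g' = g) ∨
      (v = w (q + L) + g.vec ∧ g' = g.opp) := by
    rintro v g' (⟨i, hi, h1, h2⟩ | ⟨i, hi, h1, h2⟩) <;>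
      rcases (Nat.lt_succ_iff.1 hi).lt_or_eq with hi | rfl
    · rw [c_le i hi.le] at h1
      rw [δ_lt i hi] at h2
      rw [← h1, ← h2]
      exact .inl (H.bond_out h0 _)
    · rw [c_le i le_rfl] at h1
      rw [δ_last] at h2
      exact .inr (.inl ⟨h1.symm, h2.symm⟩)
    · rw [c_le i hi.le] at h1
      rw [δ_lt i hi] at h2
      have := H.bond_out h0 (q + i)
      rw [h1, h2] at this
      exact .inl (E_opp.1 this)
    · rw [c_le i le_rfl] at h1
      rw [δ_last] at h2
      rw [h1, h2, add_vec_opp, Dir.opp_opp]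
      exact .inr (.inr ⟨rfl, rfl⟩)
  refine ⟨winding c δ (L + 1), fun v g' h1 h2 h3 => winding_flat hc hN fun ht => ?_, ?_,
    fun v hv g' => winding_flat hc hN (not_traversed_of_forall_ne hc hN fun i hi => ?_), L + 1, ?_⟩
  · rcases hT ht with h | h | h
    · exact h1 h
    · exact h2 h
    · exact h3 h
  · have hj := winding_jump hc hN (w (q + L)) g
    have t1 : traversals c δ (L + 1) (w (q + L)) g = 1 := by
      rw [traversals, Finset.sum_range_succ, if_pos ⟨c_le L le_rfl, δ_last⟩,
        Finset.sum_eq_zero, zero_add]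
      intro i hi
      rw [Finset.mem_range] at hi
      rw [if_neg]
      rintro ⟨h1, h2⟩
      rw [c_le i hi.le] at h1
      rw [δ_lt i hi] at h2
      exact hg (by rw [← h1, ← h2]; exact H.bond_out h0 _)
    have t2 : traversals c δ (L + 1) (w (q + L) + g.vec) g.opp = 0 := by
      refine traversals_eq_zero fun i hi h1 h2 => ?_
      rcases (Nat.lt_succ_iff.1 hi).lt_or_eq with hi | rfl
      · rw [c_le i hi.le] at h1
        rw [δ_lt i hi] at h2
        have := H.bond_out h0 (q + i)
        rw [h1, h2] at this
        exact hg (E_opp.1 this)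
      · rw [c_le i le_rfl] at h1
        exact add_vec_ne _ _ h1.symm
    rw [t1, t2] at hj
    linarith
  · rw [c_le i (by omega)]
    exact hv _ (by omega) (by omega)
  · intro v h' g' hv
    refine winding_near hc hN (fun i hi => ?_) hv
    have hw : w (q + 0) = w q := rfl
    have hwq : ∀ i ≤ L, w (q + i) ∈ box (w q) L := fun i hi =>
      box_mono hi (mem_box_of_steps (c := fun i => w (q + i)) (H.shift q).pos i)
    rcases hi.lt_or_eq with hi | rfl
    · rw [c_le i (by omega)]
      exact hwq i (by omega)
    · rw [c_last]
      exact hwq 0 (Nat.zero_le _)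

variable {F : ℤ × ℤ → ℤ} {y : ℤ × ℤ} {g : Dir}

theorem face_prev (H : B.IsWalker h w r d) (n : ℕ) :
    F (side (!h) (w (n + 1)) (r (n + 1))) = F (side h (w n) (d n)) := by
  rw [H.pos, H.back, side_opp]

/-- A walker that does not pass over the chord sees the same value on its side. -/
theorem chord_const (H : B.IsWalker h w r d) (hF : B.IsChord F y g) {n : ℕ}
    (h1 : ¬ (w n = y ∧ Skip h (B.E (w n)) (r n) g))
    (h2 : ¬ (w n = y + g.vec ∧ Skip h (B.E (w n)) (r n) g.opp)) :
    F (side (!h) (w n) (r n)) = F (side h (w n) (d n)) ∧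
      ∀ g', Skip h (B.E (w n)) (r n) g' → Flat F (w n) g' ∧
        F (side h (w n) g') = F (side h (w n) (d n)) := by
  have hfl : ∀ g', Skip h (B.E (w n)) (r n) g' → Flat F (w n) g' := by
    intro g' hs
    refine hF _ _ hs.1 ?_ ?_
    · rintro ⟨e, rfl⟩
      exact h1 ⟨e, hs⟩
    · rintro ⟨e, rfl⟩
      exact h2 ⟨e, hs⟩
  refine ⟨by rw [H.out]; exact face_const hfl, fun g' hs => ⟨hfl g' hs, ?_⟩⟩
  rw [(hfl g' hs).eq h (!h), H.out]
  exact face_after hs fun g'' hs' _ => hfl g'' hs'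

/-- The values that a walker sees while it passes over the chord. -/
theorem chord_cross (H : B.IsWalker h w r d) (hF : B.IsChord F y g) {n : ℕ}
    (h1 : w n = y) (hs : Skip h (B.E (w n)) (r n) g) :
    F (side (!h) (w n) (r n)) = F (side h y g) ∧ F (side (!h) y g) = F (side h (w n) (d n)) := by
  have hfl : ∀ g', Skip h (B.E (w n)) (r n) g' → g' ≠ g → Flat F (w n) g' := by
    intro g' hs' hne
    refine hF _ _ hs'.1 (fun h => hne h.2) fun h => ?_
    rw [h1] at h
    exact add_vec_ne _ _ h.1.symm
  have h3 := face_before hs hfl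
  have h4 := face_after hs hfl
  rw [← H.out] at h4
  rw [← h1]
  exact ⟨h3, h4⟩

/-- A walker whose states never repeat leaves every finite set. -/
theorem eventually_notMem {n₀ : ℕ}
    (hinj : ∀ i j, n₀ ≤ i → n₀ ≤ j → w i = w j → r i = r j → i = j) {Z : Set (ℤ × ℤ)}
    (hZ : Z.Finite) : ∃ n₁, ∀ n, n₁ ≤ n → w n ∉ Z := by
  have hfin : {n | n₀ ≤ n ∧ w n ∈ Z}.Finite := by
    refine Set.Finite.of_finite_image (f := fun n => (w n, r n))
      ((hZ.prod Set.finite_univ).subset ?_) ?_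
    · rintro _ ⟨n, hn, rfl⟩
      exact Set.mk_mem_prod hn.2 (Set.mem_univ _)
    · intro i hi j hj hij
      exact hinj i j hi.1 hj.1 (Prod.ext_iff.1 hij).1 (Prod.ext_iff.1 hij).2
  obtain ⟨b, hb⟩ := hfin.bddAbove
  refine ⟨max n₀ (b + 1), fun n hn hnZ => ?_⟩
  have := hb ⟨(le_max_left _ _).trans hn, hnZ⟩
  have := (le_max_right n₀ (b + 1)).trans hn
  omega

end IsWalker

variable (B) in
/-- A counterclockwise walker whose states never repeat. -/
structure IsRay (w : ℕ → ℤ × ℤ) (r d : ℕ → Dir) : Prop extends B.IsWalker true w r d where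
  bond : B.E (w 0) (r 0)
  inj : ∀ i j, w i = w j → r i = r j → i = j

namespace IsRay

variable {F : ℤ × ℤ → ℤ} {y : ℤ × ℤ} {g : Dir}

/-- A skipped direction determines the entrance, so a ray passes over a given direction at a given
point at most once. -/
theorem cross_unique (H : B.IsRay w r d) {i j : ℕ} (hij : w i = w j)
    (hi : Skip true (B.E (w i)) (r i) g)
    (hj : Skip true (B.E (w j)) (r j) g) : i = j := by
  refine H.inj i j hij ?_
  rw [hij] at hi
  exact hi.back_unique hj (hij ▸ H.bond_back' H.bond i) (H.bond_back' H.bond j)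

theorem chord_step (H : B.IsRay w r d) (hF : B.IsChord F y g) {n : ℕ}
    (h1 : ¬ (w (n + 1) = y ∧ Skip true (B.E (w (n + 1))) (r (n + 1)) g))
    (h2 : ¬ (w (n + 1) = y + g.vec ∧ Skip true (B.E (w (n + 1))) (r (n + 1)) g.opp)) :
    F (side true (w (n + 1)) (d (n + 1))) = F (side true (w n) (d n)) := by
  rw [← (H.chord_const hF h1 h2).1, H.face_prev (F := F)]

/-- The values that the walker sees along a chord which it passes over at time `m`, on the part
of the way where it does not pass over the other end of the chord. -/
theorem chord_values (H : B.IsRay w r d) {m : ℕ} (hm : Skip true (B.E (w m)) (r m) g)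
    (hF : B.IsChord F (w m) g)
    (hjump : F (side false (w m) g) = F (side true (w m) g) + 1)
    (hsupp : ∃ z M, ∀ v h' g', F (side h' v g') ≠ 0 → v ∈ box z M) {a : ℕ} (ham : a ≤ m)
    (hno : ∀ n, a < n → w n = w m + g.vec → ¬ Skip true (B.E (w n)) (r n) g.opp) :
    (∀ n, m ≤ n → F (side true (w n) (d n)) = 0) ∧
      (∀ n, a ≤ n → n < m → F (side true (w n) (d n)) = -1) ∧
      F (side true (w m) g) = -1 := by
  obtain ⟨z, M, hM⟩ := hsupp
  have hstep : ∀ n, a ≤ n → n + 1 ≠ m →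
      F (side true (w (n + 1)) (d (n + 1))) = F (side true (w n) (d n)) := fun n hn hnm =>
    H.chord_step hF (fun hh => hnm (H.cross_unique hh.1 hh.2 hm))
      fun hh => hno (n + 1) (by omega) hh.1 hh.2
  obtain ⟨n₁, hn₁⟩ := IsWalker.eventually_notMem (n₀ := 0) (fun i j _ _ => H.inj i j)
    (box z M).finite_toSet
  have hafter : ∀ n, m ≤ n → F (side true (w n) (d n)) = F (side true (w m) (d m)) := by
    intro n hn
    induction n, hn using Nat.le_induction with
    | base => rfl
    | succ n hn ih => rw [hstep n (by omega) (by omega), ih]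
  -- After time `m` the value is constant, and the ray leaves the bounded support of `F`; the jump
  -- of 1 across the chord then fixes the earlier value as -1.
  have hm0 : F (side true (w m) (d m)) = 0 := by
    rw [← hafter (max n₁ m) (le_max_right _ _)]
    by_contra hne
    exact hn₁ _ (le_max_left _ _) (hM _ _ _ hne)
  obtain ⟨c1, c2⟩ := H.chord_cross hF rfl hm
  rw [Bool.not_true, hjump, hm0] at c2
  have c3 : F (side true (w m) g) = -1 := by linarith
  refine ⟨fun n hn => (hafter n hn).trans hm0, ?_, c3⟩
  intro n hn hnm
  obtain ⟨k, rfl⟩ := Nat.exists_eq_add_of_lt hnm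
  have hlast : F (side true (w (n + k)) (d (n + k))) = -1 := by
    rw [← c3, ← c1, H.face_prev (F := F)]
  have : ∀ j ≤ k, F (side true (w (n + j)) (d (n + j))) = F (side true (w n) (d n)) := by
    intro j hj
    induction j with
    | zero => rfl
    | succ j ih => rw [← ih (by omega), ← Nat.add_assoc, hstep _ (by omega) (by omega)]
  rw [← this k le_rfl, hlast]

/-- Two pockets of the walker do not interleave. -/
theorem pockets_noncrossing (H : B.IsRay w r d) {a b m n : ℕ} {g g' : Dir}
    (hab : a < b) (hbm : b < m) (hmn : m < n)
    (h1 : w a = w m + g.vec) (h2 : Skip true (B.E (w m)) (r m) g)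
    (h3 : Skip true (B.E (w a)) (r a) g.opp)
    (h1' : w b = w n + g'.vec) (h2' : Skip true (B.E (w n)) (r n) g')
    (h3' : Skip true (B.E (w b)) (r b) g'.opp) : False := by
  obtain ⟨F, hF, hjump, -, hM⟩ := H.exists_chord H.bond (hab.trans hbm).le h1 h2.1
  obtain ⟨v1, v2, -⟩ := H.chord_values h2 hF hjump ⟨_, hM⟩ (hab.trans hbm).le
    fun k hk hwk hs => hk.ne (H.cross_unique (h1.trans hwk.symm) h3 hs)
  have hna : ∀ k, a < k → k ≠ m → ¬ (w k = w m ∧ Skip true (B.E (w k)) (r k) g) ∧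
      ¬ (w k = w m + g.vec ∧ Skip true (B.E (w k)) (r k) g.opp) := fun k hk hkm =>
    ⟨fun hh => hkm (H.cross_unique hh.1 hh.2 h2),
      fun hh => hk.ne (H.cross_unique (h1.trans hh.1.symm) h3 hh.2)⟩
  obtain ⟨f1, f2⟩ := hna b hab hbm.ne
  obtain ⟨f3, f4⟩ := hna n (by omega) hmn.ne'
  -- The second chord is flat for `F`, but it touches the value -1 at time `b`, inside the first
  -- pocket, and the value 0 at time `n`, after it.
  obtain ⟨e1, e2⟩ := (H.chord_const hF f1 f2).2 _ h3'
  obtain ⟨e3, e4⟩ := (H.chord_const hF f3 f4).2 _ h2'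
  rw [v2 b hab.le hbm, h1', side_opp', Bool.not_true] at e2
  rw [v1 n hmn.le, e3, e2] at e4
  exact absurd e4 (by norm_num)

end IsRay

end Bonds

theorem Skip.ne {h : Bool} {e : Dir → Prop} {r g : Dir} (hs : Skip h e r g) : g ≠ r := by
  obtain ⟨-, rfl | ⟨rfl, -⟩ | ⟨rfl, -⟩⟩ := hs
  · exact turn_ne h r
  · exact turn_two_ne h r
  · exact turn_three_ne h r

/-! ### Parting points of a ray. -/

namespace Bonds

variable {Λ : Type*} {B : Bonds Λ} {h : Bool} {w L : ℕ → ℤ × ℤ} {r d ρ δ : ℕ → Dir}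

variable (B) in
/-- There is an infinite walk whose points and labels repeat up to a translation. -/
def PeriodicWalk : Prop :=
  ∃ (ω : ℕ → ℤ × ℤ) (l : ℕ) (p : ℤ × ℤ), 0 < l ∧ p ≠ 0 ∧
    (∀ n, B.graph.Adj (ω n) (ω (n + 1))) ∧ (∀ n, ω (n + l) = ω n + p) ∧
    ∀ n, B.lab (ω (n + l)) = B.lab (ω n)

/-- A walker may be started afresh just before its next step. -/
theorem IsWalker.restart (H : B.IsWalker h w r d) {g : Dir} (h0 : B.E (w 0) g) (s : ℕ) :
    B.IsWalker h (fun n => w (s + n)) (fun n => if n = 0 then turn (!h) (d s) else r (s + n))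
      (fun n => d (s + n)) := by
  refine ⟨fun n => ?_, fun n => H.pos _, fun n => ?_⟩
  · rcases eq_or_ne n 0 with rfl | hn
    · have := H.bond_out h0 s
      simp only [if_true, Nat.add_zero]
      unfold firstFrom
      rw [turn_turn_not, if_pos this]
    · simp only [if_neg hn]
      exact H.out _
  · simp only [Nat.succ_ne_zero, if_false]
    exact H.back _

/-- The artificial entrance of `restart` is the direction just before the exit in turning order, so
nothing is passed over at time 0. -/
theorem not_skip_restart {e : Dir → Prop} {δ g : Dir} (hδ : e δ)
    (hs : Skip h e (turn (!h) δ) g) : False := by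
  obtain ⟨h0, rfl | ⟨rfl, h1⟩ | ⟨rfl, h1, -⟩⟩ := hs
  · rw [turn_turn_not] at h0
    exact h0 hδ
  · rw [turn_turn_not] at h1
    exact h1 hδ
  · rw [turn_turn_not] at h1
    exact h1 hδ

/-- The walker stays below its position at time `s` from then on. -/
def Parting (B : Bonds Λ) (w : ℕ → ℤ × ℤ) (s : ℕ) : Prop := ∀ k, s < k → B.Anc (w s) (w k)

namespace IsRay

theorem reachable (hB : B.Growing) (H : B.IsRay w r d) (n : ℕ) : B.graph.Reachable 0 (w n) :=
  (hB.conn H.bond).trans (H.toIsWalker.reachable H.bond n)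

theorem eventually_notMem (H : B.IsRay w r d) {Z : Set (ℤ × ℤ)} (hZ : Z.Finite) :
    ∃ n₁, ∀ n, n₁ ≤ n → w n ∉ Z :=
  IsWalker.eventually_notMem (n₀ := 0) (fun i j _ _ => H.inj i j) hZ

theorem eventually_add_notMem (H : B.IsRay w r d) {Z : Set (ℤ × ℤ)} (hZ : Z.Finite) :
    ∃ n₁, ∀ n, n₁ ≤ n → ∀ g : Dir, w n + g.vec ∉ Z := by
  have : (⋃ g : Dir, (fun v => v + g.vec) ⁻¹' Z).Finite :=
    Set.finite_iUnion fun g => hZ.preimage (add_left_injective g.vec).injOn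
  obtain ⟨n₁, hn₁⟩ := H.eventually_notMem this
  exact ⟨n₁, fun n hn g hg => hn₁ n hn (Set.mem_iUnion.2 ⟨g, hg⟩)⟩

/-- An ancestor of a later point that is no ancestor of the starting point is visited; after the
last visit the walker stays below it. -/
theorem last_visit (H : B.IsRay w r d) {ζ : ℤ × ℤ} {s : ℕ} (hs : ∀ k, s ≤ k → B.Anc ζ (w k))
    (h2 : ¬ B.Anc ζ (w 0)) :
    ∃ q, q < s ∧ w q = ζ ∧ Parting B w q := by
  classical
  have hv : ∃ i ≤ s, w i = ζ := by
    by_contra! hcon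
    exact h2 ((hs s le_rfl).of_off (H.off H.bond (Nat.zero_le s) fun i _ hi => hcon i hi))
  obtain ⟨i, hi, hwi⟩ := hv
  have hq := Nat.findGreatest_spec (P := fun i => w i = ζ) hi hwi
  set q := Nat.findGreatest (fun i => w i = ζ) s
  have hqs : q ≤ s := Nat.findGreatest_le s
  refine ⟨q, ?_, hq, fun k hk => ?_⟩
  · refine hqs.lt_of_ne fun h => ?_
    rw [h] at hq
    exact (hs s le_rfl).1 hq
  · rw [hq]
    rcases le_total s k with h | h
    · exact hs k h
    · refine (hs s le_rfl).of_off (H.off H.bond h fun i hi1 hi2 => ?_)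
      exact Nat.findGreatest_is_greatest (P := fun i => w i = ζ) (hk.trans_le hi1) hi2

/-- By `Deep` the ray leaves the set of points whose ancestors all belong to `Z`. A minimal ancestor
outside of `Z` lies in that set itself, so it is not visited any more; its last visit is a parting
point, later than `n₀` by the choice of `Z`. -/
theorem exists_parting (hB : B.Growing) (hA : B.Deep) (H : B.IsRay w r d) (n₀ : ℕ) :
    ∃ s, n₀ ≤ s ∧ Parting B w s := by
  have hZ : ({z | B.Anc z (w 0)} ∪ w '' Set.Iic n₀).Finite :=
    (finite_anc (H.reachable hB 0)).union ((Set.finite_Iic n₀).image w)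
  obtain ⟨n₁, hn₁⟩ := H.eventually_notMem (hA _ hZ)
  have hn := hn₁ n₁ le_rfl
  simp only [Set.mem_ofPred_eq, not_and, not_forall, exists_prop] at hn
  obtain ⟨y, hy1, hy2, hy3⟩ := exists_minimal_anc (H.reachable hB n₁) (hn (H.reachable hB n₁))
  have hyD : ∀ k, n₁ ≤ k → w k ≠ y := fun k hk e => hn₁ k hk (e ▸ ⟨hy1.reachable
    (H.reachable hB n₁), hy3⟩)
  rw [Set.mem_union, not_or] at hy2
  obtain ⟨q, -, rfl, hq'⟩ := H.last_visit (s := n₁) (ζ := y) (fun k hk =>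
    hy1.of_off (H.off H.bond hk fun i hi _ => hyD i hi).symm)
    hy2.1
  refine ⟨q, ?_, hq'⟩
  by_contra hlt
  exact hy2.2 ⟨q, (not_le.1 hlt).le, rfl⟩

/-- Two unblocked parting points in the same situation give a periodic walk. -/
theorem periodic_of_unblocked (hB : B.Growing) (H : B.IsRay w r d) {s t : ℕ} (hst : s < t)
    (hs : Parting B w s) (ht : Parting B w t)
    (hs' : ∀ m, s < m → ∀ g, Skip true (B.E (w m)) (r m) g → ¬ B.Anc (w m + g.vec) (w s))
    (ht' : ∀ m, t < m → ∀ g, Skip true (B.E (w m)) (r m) g → ¬ B.Anc (w m + g.vec) (w t))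
    (hl : B.lab (w s) = B.lab (w t)) (hd : d s = d t) : B.PeriodicWalk := by
  have unb : ∀ s, Parting B w s →
      (∀ m, s < m → ∀ g, Skip true (B.E (w m)) (r m) g → ¬ B.Anc (w m + g.vec) (w s)) →
      ∀ n g, (g = d (s + n) ∨ Skip true (B.E (w (s + n)))
        (if n = 0 then turn (!true) (d s) else r (s + n)) g) →
        ¬ B.Anc (w (s + n) + g.vec) (w (s + 0)) := by
    rintro s hs hs' n g (rfl | hg)
    · rw [← H.pos]
      exact (hs (s + n + 1) (by omega)).asymm (H.reachable hB _)
    · rcases eq_or_ne n 0 with rfl | hn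
      · rw [if_pos rfl] at hg
        exact (not_skip_restart (H.bond_out H.bond _) hg).elim
      · rw [if_neg hn] at hg
        exact hs' (s + n) (by omega) g hg
  have hne : ∀ s, Parting B w s → ∀ n, w (s + (n + 1)) ≠ 0 := by
    intro s hs n h
    have := hs (s + (n + 1)) (by omega)
    rw [h] at this
    exact not_anc_zero _ this
  have key := (H.restart H.bond s).translate hB (H.restart H.bond t) (H.bond_out H.bond _)
    (H.bond_out H.bond _) hl (by simp [hd]) (hne s hs) (hne t ht) (unb s hs hs') (unb t ht ht')
  refine ⟨fun n => w (s + n), t - s, w t - w s, by omega, ?_, fun n => H.adj H.bond _, ?_, ?_⟩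
  · intro h
    have h1 := hs t hst
    rw [sub_eq_zero.1 h] at h1
    exact h1.1 rfl
  · intro n
    have := (key n).1
    simp only [Nat.add_zero] at this
    simp only [show s + (n + (t - s)) = t + n by omega]
    exact this
  · intro n
    have := (key n).2.2
    simp only [show s + (n + (t - s)) = t + n by omega]
    exact this

end IsRay

end Bonds

/-! ### Ancestors that the ray goes around. -/

namespace Bonds

variable {Λ : Type*} {B : Bonds Λ} {w L L' : ℕ → ℤ × ℤ} {r d ρ δ ρ' δ' : ℕ → Dir}

variable (B) in
/-- At time `m` the walker passes over a visited point `w m + g` that it has gone around. -/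
structure Around (w : ℕ → ℤ × ℤ) (r : ℕ → Dir) (m : ℕ) (g : Dir) : Prop where
  cross : Skip true (B.E (w m)) (r m) g
  visited : ∃ q < m, w q = w m + g.vec ∧ Parting B w q
  single : ∀ n, w n = w m + g.vec → ¬ Skip true (B.E (w n)) (r n) g.opp
  ne_zero : w m + g.vec ≠ 0
  start_ne : w 0 ≠ w m + g.vec
  start : ¬ B.Anc (w m + g.vec) (w 0)

namespace Around

variable {m : ℕ} {g : Dir}

/-- The chord function of a walker that goes around `w m + g`: it is `-1` at everything that is
not below that point. -/
theorem exists_chord (H : B.IsRay w r d) (A : B.Around w r m g) :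
    ∃ F, B.IsChord F (w m) g ∧ F (side true (w m) g) = -1 ∧ F (side false (w m) g) = 0 ∧
      (∀ v, B.graph.Reachable 0 v → v ≠ w m + g.vec → ¬ B.Anc (w m + g.vec) v →
        ∀ h g', F (side h v g') = -1) ∧
      ∃ z M, ∀ v h' g', F (side h' v g') ≠ 0 → v ∈ box z M := by
  obtain ⟨q, hqm, hq, hpart⟩ := A.visited
  obtain ⟨F, hF, hjump, hoff, hM⟩ := H.exists_chord H.bond hqm.le hq A.cross.1
  obtain ⟨-, v2, v3⟩ := H.chord_values A.cross hF hjump ⟨_, hM⟩ (Nat.zero_le m)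
    fun n _ => A.single n
  refine ⟨F, hF, v3, by rw [hjump, v3]; norm_num, fun v hv hvne hvA h g' => ?_, _, hM⟩
  obtain ⟨p, hp⟩ := ((not_anc_iff A.start_ne).1 A.start).symm.trans ((not_anc_iff hvne).1 hvA)
  rw [← v2 0 le_rfl (by omega)]
  refine (flat_walk p (fun x hx => hoff x fun i hi1 hi2 hix => ?_) true h (d 0) g').symm
  classical
  rcases hi1.lt_or_eq with hi | rfl
  · have hA := hpart i hi
    rw [hix, hq] at hA
    exact A.start (hA.of_off ⟨p.takeUntil x hx, fun hh => hp
      (p.support_takeUntil_subset_support hx hh)⟩)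
  · exact hp (by rw [← hq, hix]; exact hx)

section left

variable {F : ℤ × ℤ → ℤ} {g₁ : Dir}

/-- If it did, the clockwise walker would be the ray after time `m` in reverse, and the ray would
have to come back to `w m + g` after its parting from that point. -/
theorem left_not_cross_near (H : B.IsRay w r d) (A : B.Around w r m g)
    (HL : B.IsWalker false L ρ δ) (h0 : B.E (L 0) g₁) (hL : L 0 = w m + g.vec) (n : ℕ) :
    ¬ (L n = w m ∧ Skip false (B.E (L n)) (ρ n) g) := by
  rintro ⟨h1, h2⟩
  cases n with
  | zero => exact add_vec_ne _ _ (hL.symm.trans h1)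
  | succ n =>
    have key : ∀ j k, j + k = n → L (k + 1) = w (m + j) ∧ ρ (k + 1) = d (m + j) := by
      intro j
      induction j with
      | zero =>
        intro k hk
        obtain rfl : k = n := by omega
        refine ⟨h1, ?_⟩
        rw [Nat.add_zero, H.out]
        have hb := HL.bond_back h0 k
        rw [h1] at h2 hb
        exact A.cross.eq_firstFrom h2 (H.bond_back' H.bond m) hb
      | succ j ih =>
        intro k hk
        obtain ⟨e1, e2⟩ := ih (k + 1) (by omega)
        have e3 : L (k + 1) = w (m + (j + 1)) := by
          rw [← Nat.add_assoc, H.pos, ← e1, ← e2, HL.pos (k + 1), HL.back, add_vec_opp]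
        have e4 : δ (k + 1) = r (m + (j + 1)) := by
          rw [← Nat.add_assoc, H.back, ← e2, HL.back, Dir.opp_opp]
        refine ⟨e3, ?_⟩
        rw [H.out, ← e3, ← e4, HL.out]
        exact (firstFrom_reverse (h := false) (HL.bond_back h0 k)).symm
    obtain ⟨e1, e2⟩ := key n 0 (by omega)
    obtain ⟨q, hqm, hq, hpart⟩ := A.visited
    have := hpart (m + n + 1) (by omega)
    refine this.1 ?_
    rw [H.pos, ← e1, ← e2, HL.pos 0, HL.back, add_vec_opp, hL, hq]

/-- The walker starts on the side of the chord with value 0. To pass over the chord from `w m + g`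
it would have to arrive on the side with value -1. -/
theorem left_values (H : B.IsRay w r d) (A : B.Around w r m g)
    (HL : B.IsWalker false L ρ δ) (h0 : B.E (L 0) g₁) (hL : L 0 = w m + g.vec)
    (hρ : ρ 0 = g.opp) (hF : B.IsChord F (w m) g) (h1 : F (side true (w m) g) = -1)
    (h2 : F (side false (w m) g) = 0) (n : ℕ) :
    F (side false (L n) (δ n)) = 0 ∧ F (side true (L n) (ρ n)) = 0 ∧
      ¬ (L n = w m + g.vec ∧ Skip false (B.E (L n)) (ρ n) g.opp) := by
  have hnear := left_not_cross_near H A HL h0 hL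
  induction n with
  | zero =>
    have hn : ¬ (L 0 = w m + g.vec ∧ Skip false (B.E (L 0)) (ρ 0) g.opp) := fun hh =>
      hh.2.ne hρ.symm
    have := (HL.chord_const hF (hnear 0) hn).1
    rw [Bool.not_false] at this
    refine ⟨?_, ?_, hn⟩
    · rw [← this, hL, hρ, side_opp']
      exact h2
    · rw [hL, hρ, side_opp']
      exact h2
  | succ n ih =>
    have hp := HL.face_prev (F := F) n
    rw [ih.1] at hp
    have hn : ¬ (L (n + 1) = w m + g.vec ∧ Skip false (B.E (L (n + 1))) (ρ (n + 1)) g.opp) := by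
      intro hh
      have := (HL.chord_cross hF.symm hh.1 hh.2).1
      rw [hp, side_opp', Bool.not_false, h1] at this
      norm_num at this
    have := (HL.chord_const hF (hnear _) hn).1
    exact ⟨by rw [← this, hp], hp, hn⟩

theorem left_below (hB : B.Growing) (H : B.IsRay w r d) (A : B.Around w r m g)
    (HL : B.IsWalker false L ρ δ) (h0 : B.E (L 0) g₁) (hL : L 0 = w m + g.vec)
    (hρ : ρ 0 = g.opp) (n : ℕ) : L n = w m + g.vec ∨ B.Anc (w m + g.vec) (L n) := by
  obtain ⟨F, hF, h1, h2, h3, -⟩ := A.exists_chord H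
  by_contra! hcon
  have := (left_values H A HL h0 hL hρ hF h1 h2 n).1
  rw [h3 _ ((hB.conn h0).trans (HL.reachable h0 n)) hcon.1 hcon.2] at this
  norm_num at this

/-- Ancestors of the start are not below it, so all squares there have value -1, while the walker
sees only 0. -/
theorem left_unblocked (hB : B.Growing) (H : B.IsRay w r d) (A : B.Around w r m g)
    (HL : B.IsWalker false L ρ δ) (h0 : B.E (L 0) g₁) (hL : L 0 = w m + g.vec)
    (hρ : ρ 0 = g.opp) (n : ℕ) (g' : Dir)
    (hg' : g' = δ n ∨ Skip false (B.E (L n)) (ρ n) g') : ¬ B.Anc (L n + g'.vec) (L 0) := by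
  intro hA
  have hreach := hB.conn h0
  have key : ¬ B.Anc (L 0) (L n + g'.vec) := hA.asymm hreach
  rcases hg' with rfl | hs
  · rw [← HL.pos] at hA key
    rcases left_below hB H A HL h0 hL hρ (n + 1) with h | h
    · exact hA.1 (hL.trans h.symm)
    · rw [← hL] at h
      exact key h
  · obtain ⟨F, hF, h1, h2, h3, -⟩ := A.exists_chord H
    obtain ⟨v1, v2, v3⟩ := left_values H A HL h0 hL hρ hF h1 h2 n
    have := ((HL.chord_const hF (left_not_cross_near H A HL h0 hL n) v3).2 g' hs).2
    rw [hL] at hA key hreach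
    rw [v1, ← side_opp false, h3 _ (hA.reachable hreach) hA.1.symm key] at this
    norm_num at this

/-- Times start at 1 because the entrance `g.opp` at time 0 is not a bond and reversibility fails
there. A repetition pulled back to time 1 would mean leaving `w m + g` by the first exit once more,
hence passing over the chord. -/
theorem left_injective (H : B.IsRay w r d) (A : B.Around w r m g)
    (HL : B.IsWalker false L ρ δ) (h0 : B.E (L 0) g₁) (hL : L 0 = w m + g.vec)
    (hρ : ρ 0 = g.opp) (i j : ℕ) (hi : 1 ≤ i) (hj : 1 ≤ j) (hij : L i = L j)
    (hij' : ρ i = ρ j) : i = j := by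
  obtain ⟨F, hF, h1, h2, h3, -⟩ := A.exists_chord H
  have key : ∀ i k, L (i + 1) = L (i + 1 + k) → ρ (i + 1) = ρ (i + 1 + k) → k = 0 := by
    intro i k e1 e2
    have e := (HL.shift 1).state_zero (HL.bond_back h0 0) (i := i) (j := k)
      (by convert e1 using 2 <;> ring) (by convert e2 using 2 <;> ring)
    simp only [Nat.add_zero] at e
    by_contra hk
    obtain ⟨k, rfl⟩ := Nat.exists_eq_succ_of_ne_zero hk
    obtain ⟨e3, e4⟩ := e
    rw [show 1 + k.succ = (k + 1) + 1 by omega] at e3 e4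
    change L (0 + 1) = _ at e3
    change ρ (0 + 1) = _ at e4
    rw [HL.back, HL.back] at e4
    have e5 := opp_injective e4
    rw [HL.pos, HL.pos, e5] at e3
    have e6 := add_right_cancel e3
    refine (left_values H A HL h0 hL hρ hF h1 h2 (k + 1)).2.2 ⟨e6.symm.trans hL, ?_⟩
    refine skip_of_firstFrom_eq (HL.bond_back h0 k) ?_ ?_
    · rw [← e6, hL, E_opp]
      exact A.cross.1
    · rw [← HL.out, ← e5, HL.out, hρ, e6]
  obtain ⟨i, rfl⟩ := Nat.exists_eq_add_of_le' hi
  obtain ⟨j, rfl⟩ := Nat.exists_eq_add_of_le' hj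
  rcases le_total i j with h | h <;> obtain ⟨k, rfl⟩ := Nat.exists_eq_add_of_le h
  · have := key i k (by rw [hij]; congr 1; omega) (by rw [hij']; congr 1; omega)
    omega
  · have := key j k (by rw [← hij]; congr 1; omega) (by rw [← hij']; congr 1; omega)
    omega

end left

/-- Going around two points in the same way gives a periodic walk. -/
theorem periodic {m' : ℕ} (hB : B.Growing) (H : B.IsRay w r d) (A : B.Around w r m g)
    (A' : B.Around w r m' g) (hl : B.lab (w m + g.vec) = B.lab (w m' + g.vec))
    (hA : B.Anc (w m + g.vec) (w m' + g.vec)) : B.PeriodicWalk := by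
  obtain ⟨L, ρ, δ, HL, hL, hρ⟩ := B.exists_walker false (w m + g.vec) g.opp
  obtain ⟨L', ρ', δ', HL', hL', hρ'⟩ := B.exists_walker false (w m' + g.vec) g.opp
  have bond : ∀ {m}, B.Around w r m g → ∃ g₁, B.E (w m + g.vec) g₁ := by
    intro m A
    obtain ⟨q, -, hq, -⟩ := A.visited
    exact ⟨_, by rw [← hq]; exact H.bond_out H.bond q⟩
  obtain ⟨g₁, h0⟩ := bond A
  obtain ⟨g₁', h0'⟩ := bond A'
  have hreach' := hB.conn h0'
  rw [← hL] at h0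
  rw [← hL'] at h0'
  have hne : ∀ {m L} {ρ δ : ℕ → Dir} {g₁} (A : B.Around w r m g) (HL : B.IsWalker false L ρ δ)
      (h0 : B.E (L 0) g₁) (hL : L 0 = w m + g.vec) (hρ : ρ 0 = g.opp), ∀ n, L (n + 1) ≠ 0 := by
    intro m L ρ δ g₁ A HL h0 hL hρ n hn
    rcases left_below hB H A HL h0 hL hρ (n + 1) with h | h
    · exact A.ne_zero (h.symm.trans hn)
    · rw [hn] at h
      exact not_anc_zero _ h
  have htr := HL.translate hB HL' h0 h0' (by rw [hL, hL', hl]) (hρ.trans hρ'.symm)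
    (hne A HL h0 hL hρ) (hne A' HL' h0' hL' hρ') (left_unblocked hB H A HL h0 hL hρ)
    (left_unblocked hB H A' HL' h0' hL' hρ')
  obtain ⟨F, hF, h1, h2, h3, z, M, hM⟩ := A'.exists_chord H
  -- the first walker has to pass over the second chord
  obtain ⟨n, hn1, hn2⟩ :
      ∃ n, L n = w m' + g.vec ∧ Skip false (B.E (L n)) (ρ n) g.opp := by
    by_contra! hcon
    -- Without passing over the second chord at its far end, the walker would see the value -1
    -- forever and remain in a box, although its states do not repeat.
    have hC : ∀ h g', F (side h (L 0) g') = -1 := by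
      rw [hL]
      exact h3 _ (hA.reachable hreach') hA.1.symm (hA.asymm hreach')
    have hval : ∀ n, F (side false (L n) (δ n)) = -1 := by
      intro n
      induction n with
      | zero => exact hC _ _
      | succ n ih =>
        have hp := HL.face_prev (F := F) n
        have hny : ¬ (L (n + 1) = w m' ∧ Skip false (B.E (L (n + 1))) (ρ (n + 1)) g) := by
          rintro ⟨e1, e2⟩
          have := (HL.chord_cross hF e1 e2).1
          rw [hp, ih, h2] at this
          norm_num at this
        rw [← (HL.chord_const hF hny fun hh => hcon _ hh.1 hh.2).1, hp, ih]
    obtain ⟨n₁, hn₁⟩ := IsWalker.eventually_notMem (left_injective H A HL h0 hL hρ)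
      (box z M).finite_toSet
    exact hn₁ n₁ le_rfl (hM _ false (δ n₁) (by rw [hval]; norm_num))
  have hn0 : n ≠ 0 := by
    rintro rfl
    exact hA.1 (hn1.symm.trans hL)
  obtain ⟨k, rfl⟩ := Nat.exists_eq_succ_of_ne_zero hn0
  -- Passing over the direction in which the second walker is entered gives the same exit. So from
  -- here on the first walker is the second one, which is also its translate.
  have hδ : δ (k + 1) = δ' 0 := by
    rw [HL.out, HL'.out, hn2.firstFrom_eq (HL.bond_back h0 k), hn1, hL', hρ']
  have hsame : ∀ i, L (k + 1 + i) = L' i := by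
    intro i
    cases i with
    | zero => exact hn1.trans hL'.symm
    | succ i =>
      have := HL.unique HL' (i := k + 1 + 1) (j := 0 + 1)
        (by rw [HL.pos (k + 1), HL'.pos 0, hδ, hL', hn1])
        (by rw [HL.back (k + 1), HL'.back 0, hδ]) i
      rw [show k + 1 + (i + 1) = k + 1 + 1 + i by omega, this.1]
      congr 1
      omega
  refine ⟨L, k + 1, L' 0 - L 0, Nat.succ_pos k, ?_, HL.adj h0, fun i => ?_, fun i => ?_⟩
  · rw [hL, hL', sub_ne_zero]
    exact hA.1
  · rw [Nat.add_comm, hsame]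
    exact (htr i).1
  · rw [Nat.add_comm, hsame]
    exact (htr i).2.2

end Around

/-! ### The extremal pocket, and the periodic walk in the deep case. -/

/-- If finite sets bound the ancestors of finitely many points only, a walker that runs to
infinity gives a periodic walk. -/
theorem Deep.periodicWalk [Finite Λ] (hB : B.Growing) (hA : B.Deep)
    (hinf : {v | B.graph.Reachable 0 v}.Infinite) : B.PeriodicWalk := by
  obtain ⟨w, r, d, H, h0, hinj⟩ := hA.exists_walker_injective hB hinf
  replace H : B.IsRay w r d := ⟨H, h0, hinj⟩
  by_contra hper
  have hunb : {s | Parting B w s ∧ ∀ m, s < m → ∀ g, Skip true (B.E (w m)) (r m) g →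
      ¬ B.Anc (w m + g.vec) (w s)}.Finite := by
    by_contra hfin
    obtain ⟨s, hs, t, ht, hst, he⟩ := Set.Infinite.exists_lt_map_eq_of_mapsTo
      (f := fun s => (B.lab (w s), d s)) hfin (fun _ _ => Set.mem_univ _) Set.finite_univ
    exact hper (H.periodic_of_unblocked hB hst hs.1 ht.1 hs.2 ht.2 (Prod.ext_iff.1 he).1
      (Prod.ext_iff.1 he).2)
  have haround : {ζ | ∃ m g, B.Around w r m g ∧ w m + g.vec = ζ}.Finite := by
    by_contra hfin
    obtain ⟨⟨l, g⟩, -, hlg⟩ := exists_infinite_fiber hfin (Set.finite_univ (α := Λ × Dir))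
        (R := fun k ζ => B.lab ζ = k.1 ∧ ∃ m, B.Around w r m k.2 ∧ w m + k.2.vec = ζ) (by
      rintro ζ ⟨m, g, A, rfl⟩
      exact ⟨(B.lab (w m + g.vec), g), Set.mem_univ _, rfl, m, A, rfl⟩)
    obtain ⟨-, ⟨-, hl, m, A, rfl⟩, -, ⟨-, hl', m', A', rfl⟩, hne⟩ := hlg.nontrivial
    obtain ⟨q, -, hq, hp⟩ := A.visited
    obtain ⟨q', -, hq', hp'⟩ := A'.visited
    have e1 := hp (max q q' + 1) (by omega)
    have e2 := hp' (max q q' + 1) (by omega)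
    rw [hq] at e1
    rw [hq'] at e2
    rcases e1.total e2 (H.reachable hB _) with h | h | h
    · exact hne h
    · exact hper (A.periodic hB H A' (hl.trans hl'.symm) h)
    · exact hper (A'.periodic hB H A (hl'.trans hl.symm) h)
  obtain ⟨b₁, hb₁⟩ := hunb.bddAbove
  obtain ⟨b₂, hb₂⟩ := H.eventually_add_notMem haround
  obtain ⟨b₃, hb₃⟩ := H.eventually_add_notMem
    (((finite_anc (H.reachable hB 0)).insert (w 0)).insert 0)
  let Pocket : ℕ → ℕ → Dir → Prop := fun a m g => a < m ∧ w a = w m + g.vec ∧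
    Skip true (B.E (w m)) (r m) g ∧ Skip true (B.E (w a)) (r a) g.opp
  -- From time `b` on, parting points are blocked, no point that the ray goes around is passed over,
  -- and neither is the origin, the starting point or one of its ancestors.
  let b := max (b₁ + 1) (max b₂ b₃)
  have hpocket : ∀ s, b ≤ s → Parting B w s →
      ∃ a q m g, a ≤ q ∧ q < s ∧ s < m ∧ Parting B w q ∧ Pocket a m g := by
    intro s hbs hs
    have hns : ∃ m, s < m ∧ ∃ g, Skip true (B.E (w m)) (r m) g ∧ B.Anc (w m + g.vec) (w s) := by
      by_contra! hcon
      have := hb₁ ⟨hs, hcon⟩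
      omega
    obtain ⟨m, hsm, g, hskip, hanc⟩ := hns
    have h3 := hb₃ m (by omega) g
    simp only [Set.mem_insert_iff, Set.mem_ofPred_eq, not_or] at h3
    have hanc' : ∀ k, s ≤ k → B.Anc (w m + g.vec) (w k) := by
      intro k hk
      rcases hk.lt_or_eq with hk | rfl
      · exact hanc.trans (hs k hk) (H.reachable hB k)
      · exact hanc
    obtain ⟨q, hqs, hq, hpq⟩ := H.last_visit hanc' h3.2.2
    by_cases hex : ∃ a, w a = w m + g.vec ∧ Skip true (B.E (w a)) (r a) g.opp
    · obtain ⟨a, ha, ha'⟩ := hex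
      have haq : a ≤ q := by
        by_contra hlt
        have := hpq a (not_le.1 hlt)
        exact this.1 (ha.trans hq.symm)
      exact ⟨a, q, m, g, haq, hqs, hsm, hpq, by omega, ha, hskip, ha'⟩
    · push Not at hex
      exact absurd ⟨m, g, ⟨hskip, ⟨q, by omega, hq, hpq⟩, hex, h3.1, fun h => h3.2.1 h.symm,
        h3.2.2⟩, rfl⟩ (hb₂ m (by omega) g)
  have hex : ∃ a, ∃ m g, b ≤ m ∧ Pocket a m g := by
    obtain ⟨s, hs, hs'⟩ := H.exists_parting hB hA b
    obtain ⟨a, q, m, g, -, -, hsm, -, hP⟩ := hpocket s hs hs'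
    exact ⟨a, m, g, by omega, hP⟩
  classical
  -- Among the pockets that end after `b`, take the earliest start `a₀` and for it the latest end
  -- `m₀`; ends are bounded because the ray leaves the neighbourhood of `w a₀`.
  obtain ⟨m₁, g₁, hm₁, hP₁⟩ := Nat.find_spec hex
  have hmin := fun a => Nat.find_min' (m := a) hex
  set a₀ := Nat.find hex
  obtain ⟨n₁, hn₁⟩ := H.eventually_add_notMem (Set.finite_singleton (w a₀))
  have hbd : ∀ m, (∃ g, b ≤ m ∧ Pocket a₀ m g) → m ≤ n₁ := by
    rintro m ⟨g, -, hP⟩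
    by_contra hlt
    exact hn₁ m (not_le.1 hlt).le g hP.2.1.symm
  obtain ⟨g₀, hm₀, hP₀⟩ := Nat.findGreatest_spec (P := fun m => ∃ g, b ≤ m ∧ Pocket a₀ m g)
    (hbd m₁ ⟨g₁, hm₁, hP₁⟩) ⟨g₁, hm₁, hP₁⟩
  have hmax : ∀ m, (∃ g, b ≤ m ∧ Pocket a₀ m g) →
      m ≤ Nat.findGreatest (fun m => ∃ g, b ≤ m ∧ Pocket a₀ m g) n₁ := fun m hm =>
    Nat.le_findGreatest (hbd m hm) hm
  set m₀ := Nat.findGreatest (fun m => ∃ g, b ≤ m ∧ Pocket a₀ m g) n₁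
  have hs := H.exists_parting hB hA m₀
  obtain ⟨hs1, hs2⟩ := Nat.find_spec hs
  have hsmin := fun k => Nat.find_min' (m := k) hs
  set s := Nat.find hs
  obtain ⟨a, q, m, g, haq, hqs, hsm, hq, hP⟩ := hpocket s (by omega) hs2
  -- As `s` is the first parting time from `m₀` on, the parting time `q < s` precedes `m₀`. So the
  -- new pocket starts before `m₀` and ends after it: it interleaves with the chosen pocket, or has
  -- the same start and a later end.
  have hqm : q < m₀ := by
    by_contra hlt
    have := hsmin q ⟨not_lt.1 hlt, hq⟩
    omega
  rcases (hmin a ⟨m, g, by omega, hP⟩).lt_or_eq with hlt | heq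
  · exact H.pockets_noncrossing hlt (by omega) (by omega) hP₀.2.1 hP₀.2.2.1 hP₀.2.2.2 hP.2.1
      hP.2.2.1 hP.2.2.2
  · rw [← heq] at hP
    have := hmax m ⟨g, by omega, hP⟩
    omega

/-! ### Pumping a path when the ancestors stay in a finite set. -/

/-- A periodic continuation of a walk that meets no ancestors consists of bonds. -/
theorem Growing.pump (hB : B.Growing) {ω : ℕ → ℤ × ℤ} {δ : ℕ → Dir} {l : ℕ} {p : ℤ × ℤ}
    (hl : 0 < l) (hω : ∀ n, ω (n + 1) = ω n + (δ n).vec) (hδ : ∀ n, δ (n + l) = δ n)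
    (hp : ∀ n, ω (n + l) = ω n + p) (hE : ∀ i < l, B.E (ω i) (δ i))
    (hlab : B.lab (ω l) = B.lab (ω 0)) (h0 : ∀ n, ω n ≠ 0) (hanc : ∀ n, ¬ B.Anc (ω n) (ω l))
    (n : ℕ) : B.E (ω n) (δ n) ∧ B.lab (ω (n + l)) = B.lab (ω n) := by
  have key : ∀ n, (∀ i < n + l, B.E (ω i) (δ i)) ∧ ∀ i ≤ n, B.lab (ω (i + l)) = B.lab (ω i) := by
    intro n
    induction n with
    | zero =>
      refine ⟨fun i hi => hE i (by omega), fun i hi => ?_⟩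
      obtain rfl : i = 0 := by omega
      rw [Nat.zero_add, hlab]
    | succ n ih =>
      obtain ⟨ih1, ih2⟩ := ih
      have hEn := ih1 n (by omega)
      have e1 : ω (n + 1 + l) = ω (n + l) + (δ n).vec := by
        rw [Nat.add_right_comm, hω, hδ]
      have hlab1 : B.lab (ω (n + 1 + l)) = B.lab (ω (n + 1)) := by
        rcases hB.grow hEn (ih2 n le_rfl).symm (by rw [← hω]; exact h0 _) with hg | hA
        · rwa [← e1, ← hω] at hg
        rw [← e1] at hA
        -- The blocking point does not separate `ω l` from the origin, so it was visited since time
        -- `l`, and its label is known one period earlier.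
        have hvis : ∃ j, l ≤ j ∧ j ≤ n + l ∧ ω j = ω (n + 1 + l) := by
          by_contra! hcon
          refine hanc _ (hA.of_off (Off.of_walk (by omega) (fun i _ hi => ?_) fun i h1 h2 =>
            hcon i h1 h2))
          rw [hω]
          exact adj_iff.2 (ih1 i hi)
        obtain ⟨j, hj1, hj2, hj⟩ := hvis
        obtain ⟨i, rfl⟩ := Nat.exists_eq_add_of_le' hj1
        have h2 : ω i = ω (n + 1) := by
          rw [hp, hp (n + 1)] at hj
          exact add_right_cancel hj
        rw [← hj, ih2 i (by omega), h2]
      refine ⟨fun i hi => ?_, fun i hi => ?_⟩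
      · rcases (show i ≤ n + l by omega).lt_or_eq with h | rfl
        · exact ih1 i h
        · rw [hδ]
          refine hB.same hEn (ih2 n le_rfl).symm ?_
          rw [← e1, hlab1, hω]
      · rcases hi.lt_or_eq with h | rfl
        · exact ih2 i (by omega)
        · exact hlab1
  exact ⟨(key (n + 1)).1 n (by omega), (key n).2 n le_rfl⟩

/-- A walk whose ends have the same label can be repeated forever if it drifts away from the
ancestors. -/
theorem Growing.periodicWalk_of_drift (hB : B.Growing) {c : ℕ → ℤ × ℤ} {l : ℕ} (hl : 0 < l)
    (hc : ∀ i < l, B.graph.Adj (c i) (c (i + 1))) (hlab : B.lab (c l) = B.lab (c 0))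
    (hne : c l ≠ c 0) (φ : ℤ × ℤ →+ ℤ) {M : ℤ} (hM : 0 ≤ M) (hφ : ∀ i ≤ l, M < φ (c i))
    (hdrift : φ (c 0) ≤ φ (c l)) (hanc : ∀ z, B.Anc z (c l) → φ z ≤ M) : B.PeriodicWalk := by
  have : ∀ i, ∃ g : Dir, i < l → B.E (c i) g ∧ c (i + 1) = c i + g.vec := by
    intro i
    by_cases hi : i < l
    · obtain ⟨g, hg⟩ := hc i hi
      exact ⟨g, fun _ => hg⟩
    · exact ⟨.east, fun h => absurd h hi⟩
  choose δ hδ using this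
  let ω : ℕ → ℤ × ℤ := fun n => c 0 + ∑ i ∈ Finset.range n, (δ (i % l)).vec
  have hω : ∀ n, ω (n + 1) = ω n + (δ (n % l)).vec := fun n => by
    simp only [ω, Finset.sum_range_succ, add_assoc]
  have hωc : ∀ i ≤ l, ω i = c i := by
    intro i hi
    induction i with
    | zero => simp [ω]
    | succ i ih => rw [hω, ih (by omega), (hδ i hi).2, Nat.mod_eq_of_lt hi]
  have hp : ∀ n, ω (n + l) = ω n + (c l - c 0) := by
    intro n
    induction n with
    | zero =>
      rw [Nat.zero_add, hωc l le_rfl, hωc 0 (Nat.zero_le _)]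
      abel
    | succ n ih =>
      rw [Nat.add_right_comm, hω, ih, Nat.add_mod_right, hω]
      abel
  have hφω : ∀ n, M < φ (ω n) := by
    intro n
    induction n using Nat.strong_induction_on with
    | _ n ih =>
      rcases lt_or_ge n l with h | h
      · rw [hωc n h.le]
        exact hφ n h.le
      · obtain ⟨k, rfl⟩ := Nat.exists_eq_add_of_le' h
        rw [hp, map_add, map_sub]
        have := ih k (by omega)
        omega
  have hpump := hB.pump (δ := fun n => δ (n % l)) hl hω (fun n => by rw [Nat.add_mod_right]) hp
    (fun i hi => by
      rw [hωc i hi.le, Nat.mod_eq_of_lt hi]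
      exact (hδ i hi).1)
    (by rw [hωc l le_rfl, hωc 0 (Nat.zero_le _), hlab])
    (fun n h => by
      have := hφω n
      rw [h, map_zero] at this
      omega)
    (fun n h => by
      rw [hωc l le_rfl] at h
      exact absurd (hanc _ h) (not_le.2 (hφω n)))
  refine ⟨ω, l, c l - c 0, hl, sub_ne_zero.2 hne, fun n => ?_, hp, fun n => (hpump n).2⟩
  rw [hω]
  exact adj_iff.2 (hpump n).1

/-- A point outside of a box is far away in one of the four directions. -/
theorem exists_far {v : ℤ × ℤ} {R : ℕ} (hv : v ∉ box 0 R) :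
    ∃ φ : ℤ × ℤ →+ ℤ, R < φ v ∧ (∀ d : Dir, φ d.vec ≤ 1) ∧ ∀ M : ℕ, ∀ z ∈ box 0 M, φ z ≤ M := by
  simp only [mem_box, Prod.fst_zero, Prod.snd_zero, sub_zero, abs_le] at hv
  have hz : ∀ M : ℕ, ∀ z ∈ box 0 M, (-(M : ℤ) ≤ z.1 ∧ z.1 ≤ M) ∧ (-(M : ℤ) ≤ z.2 ∧ z.2 ≤ M) := by
    intro M z hz
    simpa only [mem_box, Prod.fst_zero, Prod.snd_zero, sub_zero, abs_le] using hz
  by_cases h1 : (R : ℤ) < v.1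
  · refine ⟨AddMonoidHom.fst ℤ ℤ, h1, fun d => ?_, fun M z h => (hz M z h).1.2⟩
    cases d <;> simp [Dir.vec]
  by_cases h2 : (R : ℤ) < v.2
  · refine ⟨AddMonoidHom.snd ℤ ℤ, h2, fun d => ?_, fun M z h => (hz M z h).2.2⟩
    cases d <;> simp [Dir.vec]
  by_cases h3 : (R : ℤ) < -v.1
  · refine ⟨-AddMonoidHom.fst ℤ ℤ, h3, fun d => ?_, fun M z h => ?_⟩
    · cases d <;> simp [Dir.vec]
    · have := (hz M z h).1.1
      simp only [AddMonoidHom.neg_apply, AddMonoidHom.coe_fst]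
      omega
  · refine ⟨-AddMonoidHom.snd ℤ ℤ, ?_, fun d => ?_, fun M z h => ?_⟩
    · simp only [AddMonoidHom.neg_apply, AddMonoidHom.coe_snd]
      omega
    · cases d <;> simp [Dir.vec]
    · have := (hz M z h).2.1
      simp only [AddMonoidHom.neg_apply, AddMonoidHom.coe_snd]
      omega

theorem exists_subset_box {Z : Set (ℤ × ℤ)} (hZ : Z.Finite) : ∃ M, Z ⊆ box 0 M := by
  obtain ⟨M, hM⟩ := (hZ.image fun z => z.1.natAbs + z.2.natAbs).bddAbove
  refine ⟨M, fun z hz => ?_⟩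
  have := hM ⟨z, hz, rfl⟩
  simp only [Finset.mem_coe, mem_box, Prod.fst_zero, Prod.snd_zero, sub_zero, abs_le]
  simp only at this
  omega

/-- If the ancestors of infinitely many points lie in a finite set, there is a periodic walk. -/
theorem Growing.periodicWalk_of_not_deep [Finite Λ] (hB : B.Growing) (hA : ¬ B.Deep) :
    B.PeriodicWalk := by
  unfold Deep at hA
  push Not at hA
  obtain ⟨Z, hZ, hinf⟩ := hA
  obtain ⟨M, hM⟩ := exists_subset_box hZ
  have : Fintype Λ := Fintype.ofFinite Λ
  set K := Fintype.card Λ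
  obtain ⟨v, ⟨hv, hvZ⟩, hvbox⟩ := (Set.Infinite.sdiff hinf (box 0 (M + K)).finite_toSet).nonempty
  obtain ⟨φ, hφv, hφ1, hφM⟩ := exists_far hvbox
  obtain ⟨P, hP⟩ := hv.exists_isPath
  have hstep : ∀ i < P.length, φ (P.getVert (i + 1)) ≤ φ (P.getVert i) + 1 := by
    intro i hi
    obtain ⟨g, -, hg⟩ := P.adj_getVert_succ hi
    rw [hg, map_add]
    have := hφ1 g
    omega
  have hback : ∀ j ≤ P.length, φ v - j ≤ φ (P.getVert (P.length - j)) := by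
    intro j hj
    induction j with
    | zero => simp
    | succ j ih =>
      have h1 := ih (by omega)
      have h2 := hstep (P.length - (j + 1)) (by omega)
      rw [show P.length - (j + 1) + 1 = P.length - j by omega] at h2
      push_cast
      omega
  have hlen : M + K < P.length := by
    have := hback P.length le_rfl
    rw [Nat.sub_self, SimpleGraph.Walk.getVert_zero, map_zero] at this
    push_cast at hφv
    omega
  have hφP : ∀ i, P.length - K ≤ i → i ≤ P.length → (M : ℤ) < φ (P.getVert i) := by
    intro i h1 h2
    have := hback (P.length - i) (by omega)
    rw [show P.length - (P.length - i) = i by omega] at this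
    push_cast at hφv
    omega
  -- An ancestor of a point on the simple path occurs before that point and never again, so it is
  -- also an ancestor of `v` and lies in `Z`.
  have hanc : ∀ i ≤ P.length, ∀ z, B.Anc z (P.getVert i) → φ z ≤ M := by
    intro i hi z hz
    refine hφM M z (hM (hvZ z ?_))
    have hzi : ∃ j < i, P.getVert j = z := by
      by_contra! hcon
      have h0 := P.getVert_zero
      have : B.Off z (P.getVert 0) (P.getVert i) := Off.of_walk (c := P.getVert)
        (Nat.zero_le i) (fun j _ hj =>
        P.adj_getVert_succ (by omega)) fun j _ hj => by
        rcases hj.lt_or_eq with hj | rfl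
        · exact hcon j hj
        · exact hz.1
      rw [h0] at this
      exact hz.2 this
    obtain ⟨j, hj, rfl⟩ := hzi
    refine hz.of_off (Off.symm ?_)
    have : B.Off (P.getVert j) (P.getVert i) (P.getVert P.length) :=
      Off.of_walk (c := P.getVert) hi (fun j _ hj => P.adj_getVert_succ hj) fun k h1 h2 h3 => by
        have := hP.getVert_injOn (Set.mem_ofPred.2 h2) (Set.mem_ofPred.2 (hj.le.trans hi)) h3
        omega
    rwa [P.getVert_length] at this
  obtain ⟨x, y, hxy, hlab⟩ := Fintype.exists_ne_map_eq_of_card_lt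
    (fun j : Fin (K + 1) => B.lab (P.getVert (P.length - K + j))) (by simp [K])
  wlog hlt : x < y generalizing x y
  · exact this y x hxy.symm hlab.symm (lt_of_le_of_ne (not_lt.1 hlt) hxy.symm)
  have hlt' : (x : ℕ) < y := hlt
  have hy : (y : ℕ) ≤ K := Nat.lt_succ_iff.1 y.2
  have hab : P.getVert (P.length - K + x) ≠ P.getVert (P.length - K + y) := fun h => by
    have := hP.getVert_injOn (Set.mem_ofPred.2 (show P.length - K + x ≤ P.length by omega))
      (Set.mem_ofPred.2 (show P.length - K + y ≤ P.length by omega)) h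
    omega
  rcases le_total (φ (P.getVert (P.length - K + x))) (φ (P.getVert (P.length - K + y)))
    with hφ | hφ
  · refine hB.periodicWalk_of_drift (c := fun i => P.getVert (P.length - K + x + i))
      (l := (y : ℕ) - x) (by omega) (fun i hi => P.adj_getVert_succ (by omega)) ?_ ?_ φ
      (Nat.cast_nonneg M) (fun i hi => hφP _ (by omega) (by omega)) ?_ ?_ <;>
      simp only [Nat.add_zero, show P.length - K + x + (y - x) = P.length - K + y by omega]
    · exact hlab.symm
    · exact hab.symm
    · exact hφ
    · exact hanc _ (by omega)
  -- If the segment drifts towards the box, its reversal is pumped; bonds are symmetric.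
  · refine hB.periodicWalk_of_drift (c := fun i => P.getVert (P.length - K + y - i))
      (l := (y : ℕ) - x) (by omega) (fun i hi => ?_) ?_ ?_ φ
      (Nat.cast_nonneg M) (fun i hi => hφP _ (by omega) (by omega)) ?_ ?_
    · have := P.adj_getVert_succ (i := P.length - K + y - (i + 1)) (by omega)
      rw [show P.length - K + y - (i + 1) + 1 = P.length - K + y - i by omega] at this
      exact this.symm
    all_goals
      simp only [Nat.sub_zero, show P.length - K + y - (y - x) = P.length - K + x by omega]
    · exact hlab
    · exact hab
    · exact hφ
    · exact hanc _ (by omega)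

theorem Growing.periodicWalk [Finite Λ] (hB : B.Growing)
    (hinf : {v | B.graph.Reachable 0 v}.Infinite) : B.PeriodicWalk := by
  by_cases hA : B.Deep
  · exact hA.periodicWalk hB hinf
  · exact hB.periodicWalk_of_not_deep hA

/-! ### From a periodic walk to an induced periodic path. -/

/-- There is an induced infinite path from the origin that is eventually periodic. -/
theorem Growing.exists_path (hB : B.Growing) (hper : B.PeriodicWalk) :
    ∃ (V : ℕ → ℤ × ℤ) (k l : ℕ) (p : ℤ × ℤ), 0 < l ∧ V 0 = 0 ∧ Function.Injective V ∧
      (∀ n, B.graph.Adj (V n) (V (n + 1))) ∧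
      (∀ m n, B.graph.Adj (V m) (V n) → n = m + 1 ∨ m = n + 1) ∧
      (∀ n, k ≤ n → V (n + l) = V n + p ∧ B.lab (V (n + l)) = B.lab (V n)) := by
  obtain ⟨ω, l, p, hl, hp, hadj, hω, hlab⟩ := hper
  obtain ⟨P⟩ : B.graph.Reachable 0 (ω 0) := by
    obtain ⟨g, hg, -⟩ := hadj 0
    exact hB.conn hg
  -- the walk that first goes to `ω 0` and then follows `ω`
  let a := P.length
  let W : ℕ → ℤ × ℤ := fun n => if n < a then P.getVert n else ω (n - a)
  have W_lt : ∀ n < a, W n = P.getVert n := fun n hn => if_pos hn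
  have W_add : ∀ n, W (n + a) = ω n := fun n => by
    simp only [W, if_neg (show ¬ n + a < a by omega), Nat.add_sub_cancel]
  have W0 : W 0 = 0 := by
    rcases Nat.eq_zero_or_pos a with h | h
    · have := W_add 0
      rw [h] at this
      rw [this]
      exact (SimpleGraph.Walk.eq_of_length_eq_zero h).symm
    · rw [W_lt 0 h, P.getVert_zero]
  have Wadj : ∀ n, B.graph.Adj (W n) (W (n + 1)) := by
    intro n
    rcases lt_or_ge n a with h | h
    · have h1 := P.adj_getVert_succ h
      rw [W_lt n h]
      rcases (Nat.succ_le_of_lt h).lt_or_eq with h2 | h2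
      · rwa [W_lt _ h2]
      · rw [Nat.succ_eq_add_one] at h2
        have h3 := W_add 0
        rw [Nat.zero_add] at h3
        rw [h2, h3]
        rwa [h2, P.getVert_length] at h1
    · obtain ⟨i, rfl⟩ := Nat.exists_eq_add_of_le' h
      rw [Nat.add_right_comm, W_add, W_add]
      exact hadj i
  have Wper : ∀ n, a ≤ n → W (n + l) = W n + p ∧ B.lab (W (n + l)) = B.lab (W n) := by
    intro n h
    obtain ⟨i, rfl⟩ := Nat.exists_eq_add_of_le' h
    rw [Nat.add_right_comm, W_add, W_add]
    exact ⟨hω i, hlab i⟩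
  have Wperk : ∀ k n, a ≤ n → W (n + k * l) = W n + k • p ∧ B.lab (W (n + k * l)) =
      B.lab (W n) := by
    intro k n h
    induction k with
    | zero => simp
    | succ k ih =>
      rw [Nat.succ_mul, ← Nat.add_assoc]
      obtain ⟨h1, h2⟩ := Wper (n + k * l) (by omega)
      exact ⟨by rw [h1, ih.1, succ_nsmul, add_assoc], h2.trans ih.2⟩
  -- the walk visits every point finitely often
  have hfin : ∀ v, {n | W n = v}.Finite := by
    intro v
    have h1 : {n | a ≤ n ∧ W n = v}.Finite := by
      refine Set.Finite.of_finite_image (f := fun n => n % l)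
        ((Set.finite_lt_nat l).subset ?_) ?_
      · rintro _ ⟨n, -, rfl⟩
        exact Nat.mod_lt n hl
      · have key : ∀ m n, a ≤ m → W m = v → W n = v → m % l = n % l → m ≤ n → m = n := by
          intro m n hm h1 h2 h3 h4
          obtain ⟨k, hk⟩ := (Nat.modEq_iff_dvd' h4).1 h3
          obtain rfl : n = m + k * l := by
            rw [Nat.mul_comm, ← hk]
            omega
          rw [(Wperk k m hm).1, h1, add_eq_left] at h2
          rcases smul_eq_zero.1 h2 with rfl | h
          · simp
          · exact absurd h hp
        rintro m ⟨hm, hm'⟩ n ⟨hn, hn'⟩ h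
        rcases le_total m n with hmn | hmn
        · exact key m n hm hm' hn' h hmn
        · exact (key n m hn hn' hm' h.symm hmn).symm
    refine ((Set.finite_lt_nat a).union h1).subset fun n hn => ?_
    rcases lt_or_ge n a with h | h
    · exact .inl h
    · exact .inr ⟨h, hn⟩
  -- from every point, jump ahead as far as possible
  have hnx : ∀ i, ∃ j, B.graph.Adj (W i) (W j) ∧ ∀ j', B.graph.Adj (W i) (W j') → j' ≤ j := by
    intro i
    have hf : {j | B.graph.Adj (W i) (W j)}.Finite := by
      refine (Set.finite_iUnion fun g : Dir => hfin (W i + g.vec)).subset ?_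
      rintro j ⟨g, -, hg⟩
      exact Set.mem_iUnion.2 ⟨g, hg⟩
    exact Set.exists_max_image _ id hf ⟨i + 1, Wadj i⟩
  choose nx hnx1 hnx2 using hnx
  have nx_gt : ∀ i, i < nx i := fun i => hnx2 i (i + 1) (Wadj i)
  have shift : ∀ k i j, a ≤ i → a ≤ j →
      (B.graph.Adj (W (i + k * l)) (W (j + k * l)) ↔ B.graph.Adj (W i) (W j)) := by
    intro k i j hi hj
    obtain ⟨h1, h2⟩ := Wperk k i hi
    obtain ⟨h3, h4⟩ := Wperk k j hj
    constructor
    · rintro ⟨g, hE, hg⟩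
      have hg' : W j = W i + g.vec := by
        rw [h1, h3, add_right_comm] at hg
        exact add_right_cancel hg
      exact ⟨g, hB.same hE h2 (by rw [← hg, ← hg', h4]), hg'⟩
    · rintro ⟨g, hE, hg⟩
      have hg' : W (j + k * l) = W (i + k * l) + g.vec := by
        rw [h1, h3, hg, add_right_comm]
      exact ⟨g, hB.same hE h2.symm (by rw [← hg, ← hg', h4]), hg'⟩
  have nx_shift : ∀ k i, a ≤ i → nx (i + k * l) = nx i + k * l := by
    intro k i hi
    have h1 := nx_gt i
    have h2 := nx_gt (i + k * l)
    apply le_antisymm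
    · obtain ⟨j, hj⟩ := Nat.exists_eq_add_of_le' (show k * l ≤ nx (i + k * l) by omega)
      have := hnx1 (i + k * l)
      rw [hj, shift k i j hi (by omega)] at this
      have := hnx2 i j this
      omega
    · exact hnx2 _ _ ((shift k i (nx i) hi (by omega)).2 (hnx1 i))
  let idx : ℕ → ℕ := fun k => nx^[k] 0
  have idx_succ : ∀ k, idx (k + 1) = nx (idx k) := fun k => Function.iterate_succ_apply' _ _ _
  have idx_mono : StrictMono idx := strictMono_nat_of_lt_succ fun k => by
    rw [idx_succ]
    exact nx_gt _
  -- The longest jumps commute with shifts by the period, so two jump indices congruent modulo `l`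
  -- make their sequence periodic. Starting at `a + k` ensures that the indices are past the initial
  -- piece.
  obtain ⟨m, -, n, -, hmn, hmod⟩ := (Set.infinite_univ (α := ℕ)).exists_lt_map_eq_of_mapsTo
    (f := fun k => idx (a + k) % l) (t := {i | i < l}) (fun k _ => Nat.mod_lt _ hl)
    (Set.finite_lt_nat l)
  have hlt : idx (a + m) ≤ idx (a + n) := idx_mono.monotone (by omega)
  obtain ⟨t, ht⟩ := (Nat.modEq_iff_dvd' hlt).1 hmod
  have hidx : ∀ i, idx (a + n + i) = idx (a + m + i) + t * l := by
    intro i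
    induction i with
    | zero =>
      rw [Nat.add_zero, Nat.add_zero, Nat.mul_comm, ← ht]
      omega
    | succ i ih =>
      have := idx_mono.id_le (a + m + i)
      simp only [id_eq] at this
      rw [← Nat.add_assoc, ← Nat.add_assoc, idx_succ, idx_succ, ih, nx_shift _ _ (by omega)]
  have hind : ∀ m n, m < n → B.graph.Adj (W (idx m)) (W (idx n)) → n = m + 1 := by
    intro m n hmn h
    have h1 := hnx2 _ _ h
    rw [← idx_succ, idx_mono.le_iff_le] at h1
    omega
  have hinj : ∀ m n, m < n → W (idx m) ≠ W (idx n) := by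
    intro m n hmn h
    have h1 := Wadj (idx n)
    rw [← h] at h1
    have h2 := hnx2 _ _ h1
    rw [← idx_succ] at h2
    have h3 : idx (m + 1) ≤ idx n := idx_mono.monotone hmn
    omega
  refine ⟨fun k => W (idx k), a + m, n - m, t • p, by omega, W0, ?_, fun k => ?_, fun i j hij => ?_,
    fun k hk => ?_⟩
  · intro i j hij
    rcases lt_trichotomy i j with h | h | h
    · exact absurd hij (hinj i j h)
    · exact h
    · exact absurd hij.symm (hinj j i h)
  · simp only [idx_succ]
    exact hnx1 _
  · rcases lt_trichotomy i j with h | rfl | h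
    · exact .inl (hind i j h hij)
    · exact absurd hij (B.graph.loopless.irrefl _)
    · exact .inr (hind j i h hij.symm)
  · obtain ⟨i, rfl⟩ := Nat.exists_eq_add_of_le hk
    have h1 := idx_mono.id_le (a + m + i)
    simp only [id_eq] at h1
    simp only [show a + m + i + (n - m) = a + n + i by omega, hidx]
    exact Wperk t _ (by omega)

end Bonds

/-! ### Ultimately periodic words. -/

section words

theorem get_ultPeriodicWord {δ : ℕ → Dir} {k l : ℕ} (hδ : ∀ n, k ≤ n → δ (n + l) = δ n)
    (hp : (List.range l).map (fun i => δ (k + i)) ≠ []) (n : ℕ) :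
    (ultPeriodicWord ((List.range k).map δ) ((List.range l).map fun i => δ (k + i)) hp).get n
      = δ n := by
  have hl : 0 < l := by
    rw [Nat.pos_iff_ne_zero]
    rintro rfl
    simp at hp
  have hc : ∀ n, (Stream'.cycle ((List.range l).map fun i => δ (k + i)) hp).get n = δ (k + n) := by
    intro n
    induction n using Nat.strong_induction_on with
    | _ n ih =>
      rw [Stream'.cycle_eq]
      rcases lt_or_ge n l with h | h
      · rw [Stream'.get_append_left _ _ _ (by simpa using h)]
        simp
      · obtain ⟨j, rfl⟩ := Nat.exists_eq_add_of_le h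
        have := Stream'.get_append_right j ((List.range l).map fun i => δ (k + i))
          (Stream'.cycle ((List.range l).map fun i => δ (k + i)) hp)
        rw [List.length_map, List.length_range] at this
        rw [this, ih j (by omega), ← hδ (k + j) (by omega)]
        congr 1
        omega
  unfold ultPeriodicWord
  rcases lt_or_ge n k with h | h
  · rw [Stream'.get_append_left _ _ _ (by simpa using h)]
    simp
  · obtain ⟨j, rfl⟩ := Nat.exists_eq_add_of_le h
    have := Stream'.get_append_right j ((List.range k).map δ)
      (Stream'.cycle ((List.range l).map fun i => δ (k + i)) hp)
    rw [List.length_map, List.length_range] at this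
    rw [this, hc]

theorem displacement_map_range (δ : ℕ → Dir) (k : ℕ) :
    displacement ((List.range k).map δ) = ∑ i ∈ Finset.range k, (δ i).vec := by
  induction k with
  | zero => simp [displacement]
  | succ k ih =>
    rw [Finset.sum_range_succ, ← ih]
    simp [displacement, List.range_succ]

end words

/-! ### Assemblies: the union of the producible ones and its bonds. -/

namespace Placement

variable {Γ : Type*} {α β : Placement Γ}

/-- The bonds of a partial map. -/
def bonds (α : Placement Γ) : Bonds (Option (Tile Γ)) where
  lab := α
  E v d := ∃ t t', α v = some t ∧ α (v + d.vec) = some t' ∧ t d = t' d.opp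
  symm := by
    rintro v d ⟨t, t', h1, h2, h3⟩
    exact ⟨t', t, h2, by rwa [add_vec_opp], by rw [Dir.opp_opp, h3]⟩

theorem bonds_adj {v w : ℤ × ℤ} : α.bonds.graph.Adj v w ↔ α.bindingGraph.Adj v w := by
  constructor
  · rintro ⟨d, ⟨t, t', h1, h2, h3⟩, rfl⟩
    exact ⟨d, t, t', rfl, h1, h2, h3⟩
  · rintro ⟨d, t, t', rfl, h1, h2, h3⟩
    exact ⟨d, ⟨t, t', h1, h2, h3⟩, rfl⟩

theorem stable_iff (h0 : 0 ∈ α.dom) :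
    α.Stable ↔ ∀ v ∈ α.dom, α.bonds.graph.Reachable 0 v := by
  constructor
  · intro h v hv
    obtain ⟨p⟩ := h.coe.preconnected ⟨0, h0⟩ ⟨v, hv⟩
    let f : α.bindingGraph.coe →g α.bonds.graph :=
      ⟨Subtype.val, fun h => bonds_adj.2 h⟩
    exact ⟨p.map f⟩
  · intro h
    have key : ∀ {a v : ℤ × ℤ} (p : α.bonds.graph.Walk a v) (ha : a ∈ α.dom),
        ∃ hv : v ∈ α.dom, α.bindingGraph.coe.Reachable ⟨a, ha⟩ ⟨v, hv⟩ := by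
      intro a v p
      induction p with
      | nil => exact fun ha => ⟨ha, .refl _⟩
      | @cons a b c hadj q ih =>
        intro ha
        have hadj' := bonds_adj.1 hadj
        obtain ⟨hc, hr⟩ := ih (α.bindingGraph.edge_vert hadj'.symm)
        refine ⟨hc, SimpleGraph.Reachable.trans (SimpleGraph.Adj.reachable ?_) hr⟩
        exact hadj'
    refine ⟨(SimpleGraph.connected_iff_exists_forall_reachable _).2 ⟨⟨0, h0⟩, ?_⟩⟩
    rintro ⟨v, hv⟩
    obtain ⟨p⟩ := h v hv
    exact (key p h0).2

end Placement

namespace TAS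

variable {Γ : Type*} {T : TAS Γ}

open Classical in
/-- The union of all producible assemblies. -/
noncomputable def union (T : TAS Γ) : Placement Γ := fun v =>
  if h : ∃ t β, T.Producible β ∧ β v = some t then some h.choose else none

theorem union_eq_some (hT : T.Confluent) {v : ℤ × ℤ} {t : Tile Γ} :
    T.union v = some t ↔ ∃ β, T.Producible β ∧ β v = some t := by
  unfold union
  constructor
  · intro h
    split_ifs at h with hex
    rw [Option.some_inj] at h
    rw [← h]
    exact hex.choose_spec
  · rintro ⟨β, hβ, hv⟩
    have hex : ∃ t β, T.Producible β ∧ β v = some t := ⟨t, β, hβ, hv⟩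
    rw [dif_pos hex]
    obtain ⟨γ, hγ, hv'⟩ := hex.choose_spec
    rw [← hv', ← hv]
    exact hT γ β hγ hβ v ⟨⟨_, hv'⟩, ⟨_, hv⟩⟩

theorem Producible.reachable {β : Placement Γ} (h : T.Producible β) {v : ℤ × ℤ} (hv : v ∈ β.dom) :
    β.bonds.graph.Reachable 0 v :=
  (Placement.stable_iff ⟨_, h.2.2⟩).1 h.2.1 v hv

theorem exists_producible (T : TAS Γ) : ∃ α, T.Producible α := by
  classical
  let α : Placement Γ := fun v => if v = 0 then some T.seed else none
  have h0 : α 0 = some T.seed := if_pos rfl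
  have hα : ∀ {v t}, α v = some t → v = 0 ∧ T.seed = t := by
    intro v t h
    simp only [α] at h
    split_ifs at h with hv
    exact ⟨hv, Option.some_inj.1 h⟩
  refine ⟨α, ⟨fun v t h => .inr (hα h).2.symm, fun _ v hv w hw => ?_⟩, ?_, h0⟩
  · rw [(hα hv).1, (hα hw).1]
  · rw [Placement.stable_iff ⟨_, h0⟩]
    rintro v ⟨t, ht⟩
    rw [(hα ht).1]

theorem bonds_graph_mono {α β : Placement Γ} (h : ∀ v t, α v = some t → β v = some t) :
    α.bonds.graph ≤ β.bonds.graph := by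
  rintro u v ⟨d, ⟨t, t', h1, h2, h3⟩, rfl⟩
  exact ⟨d, ⟨t, t', h _ _ h1, h _ _ h2, h3⟩, rfl⟩

theorem Producible.seed_eq {β : Placement Γ} (h : T.Producible β) (hs : T.seed ∉ T.tiles)
    {v : ℤ × ℤ} (hv : β v = some T.seed) : v = 0 :=
  h.1.2 hs hv h.2.2

theorem union_producible (hT : T.Confluent) : T.Producible T.union := by
  have h0 : T.union 0 = some T.seed := by
    obtain ⟨β, hβ⟩ := T.exists_producible
    exact (union_eq_some hT).2 ⟨β, hβ, hβ.2.2⟩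
  refine ⟨⟨fun v t h => ?_, fun hs v hv w hw => ?_⟩, ?_, h0⟩
  · obtain ⟨β, hβ, h⟩ := (union_eq_some hT).1 h
    exact hβ.1.1 v t h
  · obtain ⟨β, hβ, hv⟩ := (union_eq_some hT).1 hv
    obtain ⟨γ, hγ, hw⟩ := (union_eq_some hT).1 hw
    rw [hβ.seed_eq hs hv, hγ.seed_eq hs hw]
  · rw [Placement.stable_iff ⟨_, h0⟩]
    rintro v ⟨t, h⟩
    obtain ⟨β, hβ, h⟩ := (union_eq_some hT).1 h
    exact (hβ.reachable ⟨t, h⟩).mono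
      (bonds_graph_mono fun v t ht => (union_eq_some hT).2 ⟨β, hβ, ht⟩)

theorem union_isMaximal (hT : T.Confluent) : T.IsMaximalAssembly T.union := by
  refine ⟨union_producible hT, fun β hβ hsub => Set.Subset.antisymm ?_ hsub⟩
  rintro v ⟨t, ht⟩
  exact ⟨t, (union_eq_some hT).2 ⟨β, hβ, ht⟩⟩

theorem eq_union_of_isMaximal (hT : T.Confluent) {α : Placement Γ} (hα : T.IsMaximalAssembly α) :
    α = T.union := by
  have hsub : ∀ v t, α v = some t → T.union v = some t := fun v t h =>
    (union_eq_some hT).2 ⟨α, hα.1, h⟩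
  have hdom := hα.2 T.union (union_producible hT) fun v ⟨t, h⟩ => ⟨t, hsub v t h⟩
  funext v
  cases hv : T.union v with
  | none =>
    cases hv' : α v with
    | none => rfl
    | some t => rw [hsub v t hv'] at hv; exact absurd hv (by simp)
  | some t =>
    obtain ⟨t', ht'⟩ : v ∈ α.dom := by
      rw [← hdom]
      exact ⟨t, hv⟩
    rw [← hv, hsub v t' ht', ht']

/-- In a confluent system, a tile type that fits next to a tile of the maximal assembly is present
there, unless its place separates that tile from the seed. -/
theorem union_eq_of_fits (hT : T.Confluent) {u : ℤ × ℤ} {g : Dir} {t s : Tile Γ}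
    (hu : T.union u = some t) (hs : s ∈ T.tiles) (hts : t g = s g.opp)
    (hA : ¬ T.union.bonds.Anc (u + g.vec) u) : T.union (u + g.vec) = some s := by
  classical
  set z := u + g.vec with hz
  have huz : u ≠ z := (add_vec_ne u g).symm
  have hoff := (Bonds.not_anc_iff huz).1 hA
  have hU := union_producible hT
  -- Everything behind `z` is removed together with `z`. What remains is connected to the origin
  -- without `z` and contains `u`, so `s` can be attached, and confluence forces `s` upon the union.
  let β : Placement Γ := fun v =>
    if v = z then some s else if T.union.bonds.Off z 0 v then T.union v else none
  have βz : β z = some s := if_pos rfl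
  have βoff : ∀ {v}, T.union.bonds.Off z 0 v → β v = T.union v := fun {v} h => by
    simp only [β, if_neg h.right_ne, if_pos h]
  have β_cases : ∀ {v t}, β v = some t → (v = z ∧ t = s) ∨
      (T.union.bonds.Off z 0 v ∧ T.union v = some t) := by
    intro v t h
    simp only [β] at h
    split_ifs at h with h1 h2
    · exact .inl ⟨h1, (Option.some_inj.1 h).symm⟩
    · exact .inr ⟨h2, h⟩
  have β0 : β 0 = some T.seed := by
    rw [βoff (Bonds.Off.refl hoff.left_ne)]
    exact hU.2.2
  refine (union_eq_some hT).2 ⟨β, ⟨⟨fun v t h => ?_, fun hseed v hv w hw => ?_⟩, ?_, β0⟩, βz⟩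
  · rcases β_cases h with ⟨-, rfl⟩ | ⟨-, h⟩
    · exact .inl hs
    · exact hU.1.1 v t h
  · have key : ∀ {v}, β v = some T.seed → v = 0 := by
      intro v hv
      rcases β_cases hv with ⟨-, rfl⟩ | ⟨-, h⟩
      · exact absurd hs hseed
      · exact hU.seed_eq hseed h
    rw [key hv, key hw]
  · rw [Placement.stable_iff ⟨_, β0⟩]
    have key : ∀ {a v : ℤ × ℤ} (p : T.union.bonds.graph.Walk a v), z ∉ p.support →
        T.union.bonds.Off z 0 a → β.bonds.graph.Reachable a v := by
      intro a v p
      induction p with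
      | nil => exact fun _ _ => .refl _
      | @cons a b c hadj q ih =>
        intro hp ha
        rw [SimpleGraph.Walk.support_cons, List.mem_cons, not_or] at hp
        have hbz : b ≠ z := fun h => hp.2 (h ▸ q.start_mem_support)
        have hb := ha.trans (.of_adj hadj ha.right_ne hbz)
        refine SimpleGraph.Reachable.trans (SimpleGraph.Adj.reachable ?_) (ih hp.2 hb)
        obtain ⟨d, ⟨t, t', h1, h2, h3⟩, rfl⟩ := hadj
        exact ⟨d, ⟨t, t', by rw [βoff ha, h1], by rw [βoff hb, h2], h3⟩, rfl⟩
    have key' : ∀ {v}, T.union.bonds.Off z 0 v → β.bonds.graph.Reachable 0 v := by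
      rintro v ⟨p, hp⟩
      exact key p hp (.refl hoff.left_ne)
    rintro v ⟨t', h⟩
    rcases β_cases h with ⟨rfl, -⟩ | ⟨h, -⟩
    · refine (key' hoff).trans (SimpleGraph.Adj.reachable ?_)
      exact ⟨g, ⟨t, s, by rw [βoff hoff, hu], by rw [← hz, βz], hts⟩, hz⟩
    · exact key' h

theorem union_growing (hT : T.Confluent) : T.union.bonds.Growing := by
  have hU := union_producible hT
  refine ⟨?_, ?_, ?_⟩
  · rintro u u' g ⟨t, t', h1, h2, h3⟩ h4 h5
    exact ⟨t, t', h4.symm.trans h1, h5.symm.trans h2, h3⟩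
  · rintro u u' g ⟨t, s, h1, h2, h3⟩ h4 h0
    by_cases hA : T.union.bonds.Anc (u' + g.vec) u'
    · exact .inr hA
    left
    -- A tile type outside of `T.tiles` is the seed, which then occurs only at the origin; hence the
    -- condition `u + g.vec ≠ 0`.
    have hs : s ∈ T.tiles := by
      by_contra hs
      rcases hU.1.1 _ _ h2 with h | rfl
      · exact hs h
      · exact h0 (hU.seed_eq hs h2)
    exact (union_eq_of_fits hT (h4.symm.trans h1) hs h3 hA).trans h2.symm
  · rintro u g ⟨t, s, h1, -⟩
    exact hU.reachable ⟨t, h1⟩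

theorem union_paraPeriodic [Finite Γ] (hT : T.Confluent) (hinf : T.union.dom.Infinite) :
    T.ParaPeriodic := by
  classical
  have hU := union_producible hT
  have hB := union_growing hT
  obtain ⟨V, k, l, p, hl, hV0, hinj, hadj, hind, hper⟩ := hB.exists_path
    (hB.periodicWalk (hinf.mono fun v hv => hU.reachable hv))
  choose δ hδE hδ using hadj
  have hδper : ∀ n, k ≤ n → δ (n + l) = δ n := by
    intro n hn
    have h1 := (hper n hn).1
    have h2 := (hper (n + 1) (by omega)).1
    rw [Nat.add_right_comm, hδ, hδ n, h1, add_right_comm] at h2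
    exact vec_injective (add_left_cancel (add_right_cancel h2))
  have hVsum : ∀ n, V n = ∑ i ∈ Finset.range n, (δ i).vec := by
    intro n
    induction n with
    | zero => simpa using hV0
    | succ n ih => rw [hδ, ih, Finset.sum_range_succ]
  have hne : (List.range l).map (fun i => δ (k + i)) ≠ [] := by
    simp [hl.ne']
  have hwalk : walkFrom 0
      (ultPeriodicWord ((List.range k).map δ) ((List.range l).map fun i => δ (k + i)) hne) = V := by
    funext n
    unfold walkFrom
    rw [zero_add, hVsum]
    exact Finset.sum_congr rfl fun i _ => by rw [get_ultPeriodicWord hδper]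
  -- The path is induced, so restricting the union to its points creates no binding edges besides
  -- its steps.
  let α : Placement Γ := fun v => if v ∈ Set.range V then T.union v else none
  have αV : ∀ n, α (V n) = T.union (V n) := fun n => if_pos ⟨n, rfl⟩
  have hVdom : ∀ n, ∃ t, T.union (V n) = some t := by
    intro n
    obtain ⟨t, t', h, -⟩ := hδE n
    exact ⟨t, h⟩
  have αdom : ∀ {v t}, α v = some t → (∃ n, V n = v) ∧ T.union v = some t := by
    intro v t h
    simp only [α] at h
    split_ifs at h with h1
    exact ⟨h1, h⟩
  have αadj : ∀ v w, α.bindingGraph.Adj v w ↔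
      ∃ i, (v = V i ∧ w = V (i + 1)) ∨ (v = V (i + 1) ∧ w = V i) := by
    have hstep : ∀ i, α.bindingGraph.Adj (V i) (V (i + 1)) := by
      intro i
      obtain ⟨t, t', h1, h2, h3⟩ := hδE i
      rw [← hδ] at h2
      exact ⟨δ i, t, t', (hδ i).symm, (αV i).trans h1, (αV (i + 1)).trans h2, h3⟩
    intro v w
    constructor
    · rintro ⟨d, t, t', rfl, h1, h2, h3⟩
      obtain ⟨⟨m, hm⟩, h1⟩ := αdom h1
      obtain ⟨⟨n, hn⟩, h2⟩ := αdom h2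
      have : T.union.bonds.graph.Adj (V m) (V n) := by
        rw [hm, hn]
        exact ⟨d, ⟨t, t', h1, h2, h3⟩, rfl⟩
      rcases hind m n this with rfl | rfl
      · exact ⟨m, .inl ⟨hm.symm, hn.symm⟩⟩
      · exact ⟨n, .inr ⟨hm.symm, hn.symm⟩⟩
    · rintro ⟨i, ⟨rfl, rfl⟩ | ⟨rfl, rfl⟩⟩
      · exact hstep i
      · exact (hstep i).symm
  have α0 : α 0 = some T.seed := by
    have := αV 0
    rw [hV0] at this
    rw [this]
    exact hU.2.2
  have hVreach : ∀ n, α.bonds.graph.Reachable 0 (V n) := by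
    intro n
    induction n with
    | zero => rw [hV0]
    | succ n ih =>
      exact ih.trans (SimpleGraph.Adj.reachable
        (Placement.bonds_adj.2 ((αadj _ _).2 ⟨n, .inl ⟨rfl, rfl⟩⟩)))
  refine ⟨T.union, union_isMaximal hT, α, ⟨⟨fun v t h => hU.1.1 v t (αdom h).2,
    fun hs v hv w hw => ?_⟩, ?_, (List.range k).map δ, (List.range l).map fun i => δ (k + i), hne,
    ⟨?_, ?_, ?_⟩, fun i => ?_⟩, ?_⟩
  · rw [hU.seed_eq hs (αdom hv).2, hU.seed_eq hs (αdom hw).2]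
  · rw [Placement.stable_iff ⟨_, α0⟩]
    rintro v ⟨t, h⟩
    obtain ⟨n, rfl⟩ := (αdom h).1
    exact hVreach n
  · rwa [hwalk]
  · rw [hwalk]
    ext v
    constructor
    · rintro ⟨t, h⟩
      exact (αdom h).1
    · rintro ⟨n, rfl⟩
      obtain ⟨t, ht⟩ := hVdom n
      exact ⟨t, (αV n).trans ht⟩
  · rw [hwalk]
    exact αadj
  · have hp : displacement ((List.range l).map fun i => δ (k + i)) = p := by
      rw [displacement_map_range (fun i => δ (k + i))]
      have := (hper k le_rfl).1
      rw [hVsum, hVsum, Finset.sum_range_add] at this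
      exact add_left_cancel this
    rw [hp, displacement_map_range, ← hVsum]
    have hi : V k + i • p = V (k + i * l) ∧ T.union (V (k + i * l)) = T.union (V k) := by
      induction i with
      | zero => simp
      | succ i ih =>
        obtain ⟨h1, h2⟩ := hper (k + i * l) (by omega)
        rw [Nat.succ_mul, ← Nat.add_assoc]
        exact ⟨by rw [h1, ← ih.1, succ_nsmul, add_assoc], h2.trans ih.2⟩
    rw [hi.1, αV, αV, hi.2]
  · rintro v ⟨t, h⟩
    rw [(αdom h).2, h]

end TAS

end TileAssembly

theorem mainTheorem1 {Γ : Type*} [Finite Γ] (T : TileAssembly.TAS Γ) (hT : T.Confluent) :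
    (∃! αmax : TileAssembly.Placement Γ, T.IsMaximalAssembly αmax) ∧
      ((∃ αmax : TileAssembly.Placement Γ, T.IsMaximalAssembly αmax ∧ αmax.dom.Finite) ∨
        T.ParaPeriodic) := by
  refine ⟨⟨T.union, TileAssembly.TAS.union_isMaximal hT, fun α hα =>
    TileAssembly.TAS.eq_union_of_isMaximal hT hα⟩, ?_⟩
  by_cases h : T.union.dom.Finite
  · exact .inl ⟨T.union, TileAssembly.TAS.union_isMaximal hT, h⟩
  · exact .inr (TileAssembly.TAS.union_paraPeriodic hT h)
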